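/- **Definitions.** For a cardinal $\rho$ and a set $X$ let $P_\rho X=\{x\subseteq X : |x|<\rho\}$. A set $C\subseteq P_\rho X$ is a *club* if every $x\in P_\rho X$ is contained in some $y\in C$, and $C$ is closed under unions of nonempty $\subseteq$-increasing sequences of length $<\operatorname{cf}\rho$. Let $\kappa\le\mu$ be cardinals, $\kappa$ inaccessible. *$\kappa$-$\mathcal L_{\kappa,\kappa}$-compactness with type omission holds for languages of size $\mu$* if for every language $\mathcal L$ (with finitary function and relation symbols) having exactly $\mu$ symbols, every set $T$ of $\mathcal L_{\kappa,\kappa}$-sentences and every $\mathcal L_{\kappa,\kappa}$-type $p$ (a set of formulas with free variables in one fixed finite set) over $\mathcal L$: if there is a club $C$ in $P_\kappa(T\cup p)$ such that for each $x\in C$ there is a (nonempty) model of $x\cap T$ that omits $x\cap p$, then there is a model of $T$ that omits $p$. Here a model omits a type if no assignment of its elements to the free variables satisfies all formulas of the type. A *$P_\kappa\mu$-tree* is a function $\mathcal T$ with domain $P_\kappa\mu$ such that every $\mathcal T_x$ is a nonempty set of functions $x\to 2$ with $|\mathcal T_x|<\kappa$, and $\eta\restriction x\in\mathcal T_x$ whenever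 $x\subseteq y\in P_\kappa\mu$ and $\eta\in\mathcal T_y$. A *cofinal branch* through $\mathcal T$ is a function $b:\mu\to 2$ with $b\restriction x\in\mathcal T_x$ for all $x\in P_\kappa\mu$. A *ladder system* on $\mathcal T$ is a set $L\subseteq\bigcup_{x\in P_\kappa\mu}\mathcal T_x$ such that * $\{x\in P_\kappa\mu : L\cap\mathcal T_x\ne\emptyset\}$ contains a club in $P_\kappa\mu$, and * whenever $\eta\in L\cap\mathcal T_x$ and $\operatorname{cf}(|x\cap\kappa|)>\omega$, there is a club $E_\eta$ in $P_{|x\cap\kappa|}x$ with $\eta\restriction y\in L$ for all $y\in E_\eta$. A cofinal branch $b$ meets $L$ *club often* if $\{x\in P_\kappa\mu : b\restriction x\in L\}$ contains a club in $P_\kappa\mu$, and it meets $L$ *cofinally* if for every $x\in P_\kappa\mu$ there is $z\in P_\kappa\mu$ with $z\supseteq x$ and $b\restriction z\in L$. **Theorem.** Let $\kappa\le\mu=\mu^{<\kappa}$ be cardinals, $\kappa$ inaccessible. The following are equivalent: 1. $\kappa$-$\mathcal L_{\kappa,\kappa}$-compactness with type omission holds for languages of size $\mu$. 2. For every $P_\kappa\mu$-tree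 $\mathcal T$ and every ladder system $L$ on $\mathcal T$ there is a cofinal branch through $\mathcal T$ that meets $L$ club often. 3. For every $P_\kappa\mu$-tree $\mathcal T$ and every ladder system $L$ on $\mathcal T$ there is a cofinal branch through $\mathcal T$ that meets $L$ cofinally. -/

import Mathlib

open Cardinal Set

universe u

namespace SubcompactLadder

/-! ### `P_ρ X` and its clubs -/

/-- `P_ρ X`: the subsets of `X` of cardinality `< ρ`. -/
def Pk {α : Type u} (ρ : Cardinal.{u}) (X : Set α) : Set (Set α) :=
  {x | x ⊆ X ∧ #x < ρ}

/-- `C` is a club in `P_ρ X` (`ρ` is not assumed to be regular): it is `⊆`-cofinal, and closed under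
unions of nonempty `⊆`-increasing sequences of length `< cf ρ`. If `ρ` is regular, then `cf ρ = ρ`;
if `cf ρ = ω`, then a club is just a cofinal set. -/
structure IsClub {α : Type u} (ρ : Cardinal.{u}) (X : Set α) (C : Set (Set α)) : Prop where
  subset : C ⊆ Pk ρ X
  cofinal : ∀ x ∈ Pk ρ X, ∃ y ∈ C, x ⊆ y
  closed : ∀ (o : Ordinal.{u}) (f : Ordinal.{u} → Set α), o ≠ 0 → o < ρ.ord.cof.ord →
    (∀ i < o, f i ∈ C) → (∀ i j, i ≤ j → j < o → f i ⊆ f j) → (⋃ i ∈ Iio o, f i) ∈ C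

/-! ### The logic `L_{κ,κ}` -/

/-- The variables of `L_{κ,κ}`: one for each ordinal below `κ`. -/
abbrev Var (κ : Cardinal.{u}) : Type u := κ.ord.ToType

/-- The formulas of `L_{κ,κ}` over the language `L`. Conjunctions are indexed by (the set of
predecessors of) an ordinal below `κ`, and a quantifier binds a set of fewer than `κ` variables. -/
inductive Formula (L : FirstOrder.Language.{u, u}) (κ : Cardinal.{u}) : Type u
  | eq (s t : L.Term (Var κ)) : Formula L κ
  | rel {n : ℕ} (R : L.Relations n) (ts : Fin n → L.Term (Var κ)) : Formula L κ
  | neg (φ : Formula L κ) : Formula L κ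
  | conj (a : Var κ) (φ : Iio a → Formula L κ) : Formula L κ
  | ex (V : Set (Var κ)) (hV : #V < κ) (φ : Formula L κ) : Formula L κ

/-- The variables occurring in a term. -/
def termVars {L : FirstOrder.Language.{u, u}} {α : Type u} : L.Term α → Set α
  | .var x => {x}
  | .func _ ts => ⋃ i, termVars (ts i)

namespace Formula

variable {L : FirstOrder.Language.{u, u}} {κ : Cardinal.{u}}

/-- The free variables of a formula. -/
def freeVars : Formula L κ → Set (Var κ)
  | eq s t => termVars s ∪ termVars t
  | rel _ ts => ⋃ i, termVars (ts i)
  | neg φ => φ.freeVars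
  | conj _ φ => ⋃ i, (φ i).freeVars
  | ex V _ φ => φ.freeVars \ V

/-- Satisfaction of a formula in the structure `M` under the assignment `v`. -/
def Realize {M : Type u} [L.Structure M] : Formula L κ → (Var κ → M) → Prop
  | eq s t, v => s.realize v = t.realize v
  | rel R ts, v => FirstOrder.Language.Structure.RelMap R fun i => (ts i).realize v
  | neg φ, v => ¬ φ.Realize v
  | conj _ φ, v => ∀ i, (φ i).Realize v
  | ex V _ φ, v => ∃ w : Var κ → M, (∀ x, x ∉ V → w x = v x) ∧ φ.Realize w

end Formula

/-- A theory: a set of sentences. -/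
def IsTheory {L : FirstOrder.Language.{u, u}} {κ : Cardinal.{u}} (T : Set (Formula L κ)) : Prop :=
  ∀ φ ∈ T, φ.freeVars = ∅

/-- A type: a set of formulas whose free variables all belong to one fixed finite set. -/
def IsType {L : FirstOrder.Language.{u, u}} {κ : Cardinal.{u}} (p : Set (Formula L κ)) : Prop :=
  ∃ X : Set (Var κ), X.Finite ∧ ∀ φ ∈ p, φ.freeVars ⊆ X

/-- There is a (nonempty) model of the theory `T` which omits the type `p`, i.e. in which no
assignment satisfies all the formulas of `p`. -/
def HasModelOmitting {L : FirstOrder.Language.{u, u}} {κ : Cardinal.{u}}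
    (T p : Set (Formula L κ)) : Prop :=
  ∃ (M : Type u) (_ : Nonempty M) (_ : L.Structure M),
    (∀ φ ∈ T, ∀ v : Var κ → M, φ.Realize v) ∧ ¬ ∃ v : Var κ → M, ∀ φ ∈ p, φ.Realize v

/-- `κ`-`L_{κ,κ}`-compactness with type omission for languages of size `μ`. A member `x` of
`P_κ (T ∪ p)` stands for the pair of the subtheory `x ∩ T` and the subtype `x ∩ p`. -/
def CompactnessWithTypeOmission (κ μ : Cardinal.{u}) : Prop :=
  ∀ L : FirstOrder.Language.{u, u}, L.card = μ →
    ∀ T p : Set (Formula L κ), IsTheory T → IsType p →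
      (∃ C, IsClub κ (T ∪ p) C ∧ ∀ x ∈ C, HasModelOmitting (x ∩ T) (x ∩ p)) →
      HasModelOmitting T p

/-! ### `P_κ μ`-trees and ladder systems -/

/-- The set of ordinals below `μ`, as a type. -/
abbrev Below (μ : Cardinal.{u}) : Type u := μ.ord.ToType

/-- The restriction `η ↾ x` of `η : y → 2` to a subset `x` of `y`. -/
def restr {α : Type u} {x y : Set α} (h : x ⊆ y) (η : y → Bool) : x → Bool :=
  fun a => η ⟨a.1, h a.2⟩

/-- A `P_κ μ`-tree. Only the levels `level x` with `x ∈ P_κ μ` matter. -/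
structure PkTree (κ μ : Cardinal.{u}) where
  level : ∀ x : Set (Below μ), Set (x → Bool)
  nonempty : ∀ x ∈ Pk κ univ, (level x).Nonempty
  restr_mem : ∀ x ∈ Pk κ univ, ∀ y ∈ Pk κ univ, ∀ (h : x ⊆ y), ∀ η ∈ level y, restr h η ∈ level x
  small : ∀ x ∈ Pk κ univ, #(level x) < κ

/-- `|x ∩ κ|` for a set `x` of ordinals below `μ`. -/
noncomputable def cardBelow (κ : Cardinal.{u}) {μ : Cardinal.{u}} (x : Set (Below μ)) :
    Cardinal.{u} :=
  #{a : Below μ | a ∈ x ∧ (a.toOrd : Ordinal.{u}) < κ.ord}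

/-- `S` is a ladder system on the tree `T`; `S x` is the set of its nodes with domain `x`, i.e. its
intersection with the level `T_x`. -/
structure IsLadderSystem {κ μ : Cardinal.{u}} (T : PkTree κ μ)
    (S : ∀ x : Set (Below μ), Set (x → Bool)) : Prop where
  subset : ∀ x, ∀ η ∈ S x, x ∈ Pk κ univ ∧ η ∈ T.level x
  club : ∃ C, IsClub κ univ C ∧ ∀ x ∈ C, (S x).Nonempty
  ladder : ∀ x, ∀ η ∈ S x, ℵ₀ < (cardBelow κ x).ord.cof →
    ∃ E, IsClub (cardBelow κ x) x E ∧ ∀ y ∈ E, ∃ h : y ⊆ x, restr h η ∈ S y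

/-- The restriction `b ↾ x` of a function `b : μ → 2`. -/
def branchRestr {μ : Cardinal.{u}} (b : Below μ → Bool) (x : Set (Below μ)) : x → Bool :=
  fun a => b a.1

/-- `b : μ → 2` is a cofinal branch through `T`. -/
def IsBranch {κ μ : Cardinal.{u}} (T : PkTree κ μ) (b : Below μ → Bool) : Prop :=
  ∀ x ∈ Pk κ univ, branchRestr b x ∈ T.level x

/-- `b` meets `S` cofinally. -/
def MeetsCofinally {μ : Cardinal.{u}} (κ : Cardinal.{u}) (b : Below μ → Bool)
    (S : ∀ x : Set (Below μ), Set (x → Bool)) : Prop :=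
  ∀ x ∈ Pk κ univ, ∃ z ∈ Pk κ univ, x ⊆ z ∧ branchRestr b z ∈ S z

/-- `b` meets `S` club often. -/
def MeetsClubOften {μ : Cardinal.{u}} (κ : Cardinal.{u}) (b : Below μ → Bool)
    (S : ∀ x : Set (Below μ), Set (x → Bool)) : Prop :=
  ∃ C, IsClub κ univ C ∧ ∀ x ∈ C, branchRestr b x ∈ S x

end SubcompactLadder

/-!
All three statements are equivalent to a combinatorial principle, `FunctionCompactness κ μ`. Some
partial functions from `μ` to `μ` of size `< κ` are forbidden; if for club many `A ∈ P_κ μ` there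
is a function from `A` to `A` which contains no forbidden partial function with domain inside `A`,
then there is a function from `μ` to `μ` which contains no forbidden partial function. Closure of
`A` under the function is what type omission expresses (every element is one of the constants with
an index in `A`), and also what survives the passage from `A` to club many smaller sets.

*Compactness with type omission implies function compactness*
(`CompactnessWithTypeOmission.functionCompactness`). The values of the function are new constants,
each forbidden partial function gives a sentence, and the type says that an element is not one of
the old constants.

*Meeting every ladder system cofinally implies function compactness*
(`functionCompactness_of_ladder`). All functions into `2` are allowed in the tree, and a node at `x`
belongs to the ladder system if it codes a total relation on `x` that contains no forbidden partial
function. Totality is inherited by the sets closed under a choice function; in `P_ρ x` they form a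
club if `cf ρ > ω`, for any `ρ`, regular or not.

For the converses, function compactness is used through `FunctionCompactness.exists_limit`: if club
many `A` carry an approximation, then there is an object which agrees with an approximation on any
fewer than `κ` of its values.

*Function compactness implies that some branch meets the ladder system club often*
(`FunctionCompactness.exists_branch`). An approximation at `A` is a node of the ladder system at
`A`, together with its ladder. If `cf |A ∩ κ| = ω` there is no ladder, and every club contains such
sets `A`. Therefore the approximation also records which ordinals are below `cf |A ∩ κ|`, with a
cofinal sequence as evidence in the negative case. In the limit such a sequence would be a short
cofinal sequence in `κ`; so the limit has a ladder, which is a club in `P_κ μ`. A member of the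
ladder is given by an enumeration whose length is an ordinal in `A ∩ κ`, so that it has size `< κ`
in the limit.

*Function compactness implies compactness with type omission*
(`FunctionCompactness.compactnessWithTypeOmission`). An approximation is a satisfaction relation for
the closed terms (`Name`) of a language with Henkin functions, together with a function which
assigns to every tuple of names a formula of the type that it fails to satisfy. In the limit, the
names modulo equality form the required model; every step in the truth lemma concerns fewer than `κ`
instances of satisfaction, which can be realized in an actual structure.
-/

namespace SubcompactLadder

/-! ### Clubs in `P_ρ X` -/

section Club

variable {α β : Type u} {ρ : Cardinal.{u}} {X : Set α}

theorem iUnion_mem_Pk {ι : Type u} (hρ : ℵ₀ ≤ ρ) (hι : #ι < ρ.ord.cof) {f : ι → Set α}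
    (hf : ∀ i, f i ∈ Pk ρ X) : ⋃ i, f i ∈ Pk ρ X := by
  refine ⟨iUnion_subset fun i => (hf i).1, (mk_iUnion_le f).trans_lt ?_⟩
  exact mul_lt_of_lt hρ (hι.trans_le (Ordinal.cof_ord_le ρ))
    (iSup_lt_of_lt_cof_ord hι fun i => (hf i).2)

theorem biUnion_mem_Pk {ι : Type u} {s : Set ι} (hρ : ℵ₀ ≤ ρ) (hι : #s < ρ.ord.cof)
    {f : ι → Set α} (hf : ∀ i ∈ s, f i ∈ Pk ρ X) : ⋃ i ∈ s, f i ∈ Pk ρ X := by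
  rw [biUnion_eq_iUnion]
  exact iUnion_mem_Pk hρ hι fun i => hf i i.2

theorem iUnion_Iio_mem_Pk (hρ : ℵ₀ ≤ ρ) {o : Ordinal.{u}} (ho : o < ρ.ord.cof.ord)
    {f : Ordinal.{u} → Set α} (hf : ∀ i < o, f i ∈ Pk ρ X) : ⋃ i ∈ Iio o, f i ∈ Pk ρ X := by
  have h : ⋃ i ∈ Iio o, f i = ⋃ i : o.ToType, f i.toOrd := by
    ext a
    simp only [mem_iUnion, exists_prop]
    constructor
    · rintro ⟨i, hi, ha⟩
      exact ⟨Ordinal.ToType.mk ⟨i, hi⟩, by simpa using ha⟩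
    · rintro ⟨i, ha⟩
      exact ⟨i.toOrd, i.toOrd.2, ha⟩
  rw [h]
  refine iUnion_mem_Pk hρ ?_ fun i => hf _ i.toOrd.2
  rwa [mk_toType, ← lt_ord]

theorem union_mem_Pk (hρ : ℵ₀ ≤ ρ) {x y : Set α} (hx : x ∈ Pk ρ X) (hy : y ∈ Pk ρ X) :
    x ∪ y ∈ Pk ρ X :=
  ⟨union_subset hx.1 hy.1, (mk_union_le x y).trans_lt (add_lt_of_lt hρ hx.2 hy.2)⟩

theorem mem_Pk_of_subset {x y : Set α} (hy : y ∈ Pk ρ X) (h : x ⊆ y) : x ∈ Pk ρ X :=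
  ⟨h.trans hy.1, (mk_le_mk_of_subset h).trans_lt hy.2⟩

theorem image_mem_Pk {Y : Set β} {x : Set β} (hx : x ∈ Pk ρ Y) {e : β → α}
    (he : ∀ a ∈ Y, e a ∈ X) : e '' x ∈ Pk ρ X :=
  ⟨image_subset_iff.2 fun a ha => he a (hx.1 ha), mk_image_le.trans_lt hx.2⟩

theorem IsClub.iUnion_nat_mem {C : Set (Set α)} (hC : IsClub ρ X C) (hρ : ℵ₀ < ρ.ord.cof)
    {s : ℕ → Set α} (hs : Monotone s) (hsC : ∀ n, s n ∈ C) : ⋃ n, s n ∈ C := by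
  -- Extend the sequence to all ordinals by unions, as clubs are stated with ordinal sequences.
  let f : Ordinal.{u} → Set α := fun i => ⋃ n : {n : ℕ // (n : Ordinal.{u}) ≤ i}, s n
  have hf : ∀ n : ℕ, f n = s n := by
    intro n
    refine Subset.antisymm (iUnion_subset fun m => hs (by exact_mod_cast m.2)) ?_
    exact subset_iUnion (fun m : {m : ℕ // (m : Ordinal.{u}) ≤ n} => s m) ⟨n, le_rfl⟩
  have := hC.closed Ordinal.omega0 f Ordinal.omega0_ne_zero
    (by rw [← ord_aleph0, ord_lt_ord]; exact hρ)
    (fun i hi => by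
      obtain ⟨n, rfl⟩ := Ordinal.lt_omega0.1 hi
      rw [hf]; exact hsC n)
    (fun i j hij _ => iUnion_subset fun n => by
      exact subset_iUnion (fun m : {m : ℕ // (m : Ordinal.{u}) ≤ j} => s m) ⟨n, n.2.trans hij⟩)
  convert this using 1
  ext a
  simp only [mem_iUnion, exists_prop]
  constructor
  · rintro ⟨n, hn⟩
    exact ⟨n, Ordinal.natCast_lt_omega0 n, by rwa [hf]⟩
  · rintro ⟨i, hi, ha⟩
    obtain ⟨n, rfl⟩ := Ordinal.lt_omega0.1 hi
    exact ⟨n, by rwa [hf] at ha⟩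

theorem iUnion_nat_mem_Pk (hρ : ℵ₀ < ρ.ord.cof) {s : ℕ → Set α} (hs : ∀ n, s n ∈ Pk ρ X) :
    ⋃ n, s n ∈ Pk ρ X := by
  have h : ⋃ n, s n = ⋃ n : ULift.{u} ℕ, s n.down := by
    ext a; simp
  rw [h]
  exact iUnion_mem_Pk (hρ.le.trans (Ordinal.cof_ord_le ρ)) (by simpa using hρ) fun n => hs _

/-- The sets containing `w` which are closed under the set-valued binary function `s` form a
club. -/
theorem isClub_closedUnder₂ (hρ : ℵ₀ < ρ.ord.cof) {w : Set α} (hw : w ∈ Pk ρ X)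
    {s : α → α → Set α} (hs : ∀ y ∈ Pk ρ X, ⋃ a ∈ y, ⋃ b ∈ y, s a b ∈ Pk ρ X) :
    IsClub ρ X {y | y ∈ Pk ρ X ∧ w ⊆ y ∧ ∀ a ∈ y, ∀ b ∈ y, s a b ⊆ y} where
  subset := fun y hy => hy.1
  cofinal := by
    intro x hx
    have hρ' : ℵ₀ ≤ ρ := hρ.le.trans (Ordinal.cof_ord_le ρ)
    let t : ℕ → Set α := fun n =>
      Nat.rec (x ∪ w) (fun _ y => y ∪ ⋃ a ∈ y, ⋃ b ∈ y, s a b) n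
    have ht : ∀ n, t n ∈ Pk ρ X := by
      intro n
      induction n with
      | zero => exact union_mem_Pk hρ' hx hw
      | succ n ih => exact union_mem_Pk hρ' ih (hs _ ih)
    have hmono : Monotone t := monotone_nat_of_le_succ fun n => subset_union_left
    have h0 : x ∪ w ⊆ ⋃ n, t n := subset_iUnion t 0
    refine ⟨⋃ n, t n, ⟨iUnion_nat_mem_Pk hρ ht, subset_union_right.trans h0, ?_⟩,
      subset_union_left.trans h0⟩
    intro a ha b hb
    obtain ⟨n, hn⟩ := mem_iUnion.1 ha
    obtain ⟨m, hm⟩ := mem_iUnion.1 hb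
    refine Subset.trans ?_ (subset_iUnion t (max n m + 1))
    intro c hc
    refine Or.inr (mem_iUnion₂.2 ⟨a, hmono (le_max_left n m) hn, mem_iUnion₂.2 ⟨b, ?_, hc⟩⟩)
    exact hmono (le_max_right n m) hm
  closed := by
    intro o f ho0 ho hf hm
    refine ⟨iUnion_Iio_mem_Pk (hρ.le.trans (Ordinal.cof_ord_le ρ)) ho fun i hi => (hf i hi).1, ?_,
      ?_⟩
    · have h0 : (0 : Ordinal.{u}) < o := pos_iff_ne_zero.2 ho0
      exact (hf 0 h0).2.1.trans (subset_biUnion_of_mem (u := f) (mem_Iio.2 h0))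
    · intro a ha b hb
      simp only [mem_iUnion, exists_prop] at ha hb
      obtain ⟨i, hi, ha⟩ := ha
      obtain ⟨j, hj, hb⟩ := hb
      have hij : max i j < o := max_lt hi hj
      exact ((hf _ hij).2.2 a (hm i _ (le_max_left i j) hij ha) b
        (hm j _ (le_max_right i j) hij hb)).trans (subset_biUnion_of_mem (u := f) hij)

/-- The sets containing `w` which are closed under the set-valued function `s` form a club. -/
theorem isClub_closedUnder (hρ : ℵ₀ < ρ.ord.cof) {w : Set α} (hw : w ∈ Pk ρ X) {s : α → Set α}
    (hs : ∀ y ∈ Pk ρ X, ⋃ a ∈ y, s a ∈ Pk ρ X) :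
    IsClub ρ X {y | y ∈ Pk ρ X ∧ w ⊆ y ∧ ∀ a ∈ y, s a ⊆ y} := by
  convert isClub_closedUnder₂ hρ hw (s := fun a _ => s a) fun y hy =>
    mem_Pk_of_subset (hs y hy) (iUnion₂_mono fun a _ => iUnion₂_subset fun _ _ => subset_rfl)
    using 5 with y
  exact ⟨fun h a ha _ _ => h a ha, fun h a ha => h a ha a ha⟩

theorem IsClub.inter {C D : Set (Set α)} (hC : IsClub ρ X C) (hD : IsClub ρ X D)
    (hρ : ℵ₀ < ρ.ord.cof) : IsClub ρ X (C ∩ D) where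
  subset := fun y hy => hC.subset hy.1
  cofinal := by
    intro x hx
    -- The union of an increasing sequence which alternates between `C` and `D` belongs to both.
    choose! p hp hxp using hC.cofinal
    choose! q hq hxq using hD.cofinal
    let t : ℕ → Set α := fun n => Nat.rec (p x) (fun _ y => p (q y)) n
    have ht : ∀ n, t n ∈ C := by
      intro n
      induction n with
      | zero => exact hp x hx
      | succ n ih => exact hp _ (hD.subset (hq _ (hC.subset ih)))
    have h1 : ∀ n, t n ⊆ q (t n) := fun n => hxq _ (hC.subset (ht n))
    have h2 : ∀ n, q (t n) ⊆ t (n + 1) := fun n => hxp _ (hD.subset (hq _ (hC.subset (ht n))))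
    have hmono : Monotone t := monotone_nat_of_le_succ fun n => (h1 n).trans (h2 n)
    refine ⟨⋃ n, t n, ⟨hC.iUnion_nat_mem hρ hmono ht, ?_⟩,
      (hxp x hx).trans (subset_iUnion t 0)⟩
    have h3 : ⋃ n, t n = ⋃ n, q (t n) :=
      Subset.antisymm (iUnion_mono h1)
        (iUnion_subset fun n => (h2 n).trans (subset_iUnion t (n + 1)))
    rw [h3]
    exact hD.iUnion_nat_mem hρ (monotone_nat_of_le_succ fun n => (h2 n).trans (h1 (n + 1)))
      fun n => hq _ (hC.subset (ht n))
  closed := fun o f h0 ho hf hm => ⟨hC.closed o f h0 ho (fun i hi => (hf i hi).1) hm,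
    hD.closed o f h0 ho (fun i hi => (hf i hi).2) hm⟩

/-- Clubs pull back along injections. -/
theorem IsClub.comap {Y : Set β} {C : Set (Set β)} (hC : IsClub ρ Y C) (hρ : ℵ₀ ≤ ρ) {e : β → α}
    (he : e.Injective) (heX : ∀ b ∈ Y, e b ∈ X) :
    IsClub ρ X {x | x ∈ Pk ρ X ∧ Y ∩ e ⁻¹' x ∈ C} where
  subset := fun y hy => hy.1
  cofinal := by
    intro x hx
    obtain ⟨y, hy, hxy⟩ := hC.cofinal (Y ∩ e ⁻¹' x) ⟨inter_subset_left,
      (mk_le_mk_of_subset inter_subset_right).trans_lt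
        ((mk_preimage_of_injective e x he).trans_lt hx.2)⟩
    -- By injectivity, adding `e '' y` to `x` adds nothing but `y` to the preimage.
    refine ⟨x ∪ e '' y, ⟨union_mem_Pk hρ hx (image_mem_Pk (hC.subset hy) heX), ?_⟩,
      subset_union_left⟩
    have : Y ∩ e ⁻¹' (x ∪ e '' y) = y := by
      rw [preimage_union, preimage_image_eq _ he, inter_union_distrib_left,
        inter_eq_right.2 (hC.subset hy).1, union_eq_right.2 hxy]
    rwa [this]
  closed := by
    intro o f h0 ho hf hm
    refine ⟨iUnion_Iio_mem_Pk hρ ho fun i hi => (hf i hi).1, ?_⟩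
    have : Y ∩ e ⁻¹' (⋃ i ∈ Iio o, f i) = ⋃ i ∈ Iio o, Y ∩ e ⁻¹' (f i) := by
      simp only [preimage_iUnion, inter_iUnion]
    rw [this]
    exact hC.closed o (fun i => Y ∩ e ⁻¹' (f i)) h0 ho (fun i hi => (hf i hi).2)
      fun i j hij hj => inter_subset_inter_right _ (preimage_mono (hm i j hij hj))

end Club

/-! ### Compactness for functions -/

variable {κ μ : Cardinal.{u}}

/-- Compactness for functions `μ → μ`. A pair `(J, t)` in `F` forbids the partial function
`t ↾ J`. If for club many `A ∈ P_κ μ` there is a function which maps `A` to itself and agrees with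
no forbidden partial function whose domain is a subset of `A`, then there is a function which agrees
with no forbidden partial function. -/
def FunctionCompactness (κ μ : Cardinal.{u}) : Prop :=
  ∀ F : Set (Set (Below μ) × (Below μ → Below μ)), (∀ p ∈ F, #p.1 < κ) →
    (∃ D, IsClub κ univ D ∧ ∀ A ∈ D, ∃ g : Below μ → Below μ, MapsTo g A A ∧
      ∀ p ∈ F, p.1 ⊆ A → ¬ EqOn g p.2 p.1) →
    ∃ g : Below μ → Below μ, ∀ p ∈ F, ¬ EqOn g p.2 p.1

theorem exists_embedding_Below {α : Type u} (h : #α ≤ μ) : Nonempty (α ↪ Below μ) := by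
  rw [← mk_ord_toType μ] at h
  exact h

theorem aleph0_lt_cof (hκ : κ.IsInaccessible) : ℵ₀ < κ.ord.cof := by
  rw [hκ.isRegular.cof_ord]; exact hκ.aleph0_lt

theorem mk_union_lt {α : Type u} (hκ : κ.IsInaccessible) {s t : Set α} (hs : #s < κ)
    (ht : #t < κ) : #(s ∪ t : Set α) < κ :=
  (mk_union_le s t).trans_lt (add_lt_of_lt hκ.isRegular.aleph0_le hs ht)

open Classical in
/-- Compactness for functions yields limits of approximations. If club many `A ∈ P_κ V` carry an
approximation, that is, a function `g : I₁ → V` with values in `A` and a predicate `h` on `I₂` with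
`Good A g h`, then there are `g` and `h` which look like an approximation on all small sets of
arguments, and the approximation can be required to belong to some `A` above a given small set. -/
theorem FunctionCompactness.exists_limit (hFC : FunctionCompactness κ μ)
    (hκ : κ.IsInaccessible) (hκμ : κ ≤ μ) {I₁ I₂ V : Type u} [Nonempty V]
    (hI₁ : #I₁ ≤ μ) (hI₂ : #I₂ ≤ μ) (hV : #V ≤ μ)
    (Good : Set V → (I₁ → V) → (I₂ → Prop) → Prop)
    (hD : ∃ D, IsClub κ univ D ∧ ∀ A ∈ D, ∃ g h, (∀ i, g i ∈ A) ∧ Good A g h) :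
    ∃ (g : I₁ → V) (h : I₂ → Prop), ∀ (J₁ : Set I₁) (J₂ : Set I₂) (w : Set V),
      #J₁ < κ → #J₂ < κ → #w < κ →
      ∃ (A : Set V) (g' : I₁ → V) (h' : I₂ → Prop), w ⊆ A ∧ Good A g' h' ∧ EqOn g g' J₁ ∧
        ∀ i ∈ J₂, h i ↔ h' i := by
  have hμ : ℵ₀ ≤ μ := hκ.aleph0_lt.le.trans hκμ
  obtain ⟨ev⟩ := exists_embedding_Below hV
  obtain ⟨e⟩ : Nonempty ((I₁ ⊕ I₂) ⊕ PUnit.{u + 1} ↪ Below μ) := by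
    refine exists_embedding_Below ?_
    rw [mk_sum, mk_sum]
    simp only [lift_id]
    exact add_le_of_le hμ (add_le_of_le hμ hI₁ hI₂) (by simpa using one_le_aleph0.trans hμ)
  obtain ⟨D, hDc, hD⟩ := hD
  -- The value `z` at the index of `i` in `I₂` encodes that `h i` holds; the index itself, as value,
  -- encodes that `h i` fails. Both keep `A` closed.
  let z : Below μ := e (.inr ⟨⟩)
  let dec₁ : (Below μ → Below μ) → I₁ → V := fun t i =>
    Function.invFun ev (t (e (.inl (.inl i))))
  let dec₂ : (Below μ → Below μ) → I₂ → Prop := fun t i => t (e (.inl (.inr i))) = z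
  let R : Set I₁ → Set I₂ → Set V → (I₁ → V) → (I₂ → Prop) → Prop := fun J₁ J₂ w g h =>
    ∃ A g' h', w ⊆ A ∧ Good A g' h' ∧ EqOn g g' J₁ ∧ ∀ i ∈ J₂, h i ↔ h' i
  let J : Set I₁ → Set I₂ → Set V → Set (Below μ) := fun J₁ J₂ w =>
    ((fun i => e (.inl (.inl i))) '' J₁ ∪ (fun i => e (.inl (.inr i))) '' J₂) ∪ ev '' w
  have hdec : ∀ J₁ J₂ w t t', EqOn t t' (J J₁ J₂ w) → R J₁ J₂ w (dec₁ t) (dec₂ t) →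
      R J₁ J₂ w (dec₁ t') (dec₂ t') := by
    rintro J₁ J₂ w t t' htt ⟨A, g, h, hA, hG, hg, hh⟩
    refine ⟨A, g, h, hA, hG, fun i hi => ?_, fun i hi => ?_⟩
    · rw [← hg hi]
      simp only [dec₁]
      rw [htt (Or.inl (Or.inl ⟨i, hi, rfl⟩))]
    · rw [← hh i hi]
      simp only [dec₂]
      rw [htt (Or.inl (Or.inr ⟨i, hi, rfl⟩))]
  let F : Set (Set (Below μ) × (Below μ → Below μ)) := {p | ∃ (J₁ : Set I₁)
    (J₂ : Set I₂) (w : Set V), #J₁ < κ ∧ #J₂ < κ ∧ #w < κ ∧ p.1 = J J₁ J₂ w ∧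
      ¬ R J₁ J₂ w (dec₁ p.2) (dec₂ p.2)}
  have happ : ∃ D, IsClub κ univ D ∧ ∀ A ∈ D, ∃ g : Below μ → Below μ, MapsTo g A A ∧
      ∀ p ∈ F, p.1 ⊆ A → ¬ EqOn g p.2 p.1 := by
    have hcof := aleph0_lt_cof hκ
    have hz : ({z} : Set (Below μ)) ∈ Pk κ univ := ⟨subset_univ _, by simpa using hκ.nat_lt 1⟩
    have h0 : (∅ : Set (Below μ)) ∈ Pk κ univ := ⟨empty_subset _, by simpa using hκ.pos⟩
    refine ⟨_, (hDc.comap hκ.aleph0_lt.le ev.injective fun _ _ => mem_univ _).inter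
      (isClub_closedUnder hcof hz (s := fun _ => ∅) fun y _ => by simpa using h0) hcof, ?_⟩
    rintro A ⟨⟨-, hA⟩, -, hzA, -⟩
    rw [univ_inter] at hA
    obtain ⟨g, h, hgA, hgR⟩ := hD _ hA
    let val : (I₁ ⊕ I₂) ⊕ PUnit.{u + 1} → Below μ
      | .inl (.inl i) => ev (g i)
      | .inl (.inr i) => if h i then z else e (.inl (.inr i))
      | .inr _ => z
    have hval : ∀ i, Function.extend e val id (e i) = val i := e.injective.extend_apply _ _
    refine ⟨Function.extend e val id, fun a ha => ?_, ?_⟩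
    · by_cases hea : ∃ i, e i = a
      · obtain ⟨i, rfl⟩ := hea
        rw [hval]
        rcases i with (i | i) | i
        · exact hgA i
        · simp only [val]
          split_ifs
          · exact hzA rfl
          · exact ha
        · exact hzA rfl
      · rwa [Function.extend_apply' _ _ _ hea]
    · rintro p ⟨J₁, J₂, w, -, -, -, hk, hkR⟩ hpA hp
      rw [hk] at hpA hp
      refine hkR (hdec J₁ J₂ w _ _ hp ?_)
      have h₁ : dec₁ (Function.extend e val id) = g := by
        funext i
        simp only [dec₁, hval, val]
        exact Function.leftInverse_invFun ev.injective (g i)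
      have h₂ : dec₂ (Function.extend e val id) = h := by
        funext i
        simp only [dec₂, hval, val]
        by_cases hi : h i <;> simp [hi, z]
      rw [h₁, h₂]
      exact ⟨_, g, h, fun v hv => hpA (Or.inr ⟨v, hv, rfl⟩), hgR, fun _ _ => rfl,
        fun _ _ => Iff.rfl⟩
  obtain ⟨g, hg⟩ := hFC F (by
    rintro p ⟨J₁, J₂, w, h₁, h₂, h₃, hk, -⟩
    rw [hk]
    exact mk_union_lt hκ (mk_union_lt hκ (mk_image_le.trans_lt h₁) (mk_image_le.trans_lt h₂))
      (mk_image_le.trans_lt h₃)) happ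
  refine ⟨dec₁ g, dec₂ g, fun J₁ J₂ w h₁ h₂ h₃ => ?_⟩
  by_contra hk
  exact hg ⟨J J₁ J₂ w, g⟩ ⟨J₁, J₂, w, h₁, h₂, h₃, rfl, hk⟩ fun _ _ => rfl

/-! ### From cofinal branches to compactness for functions -/

/-- The ladder system consists of the graphs of the approximations: a node at `x` codes a relation
on `x` which is total, and which contains none of the forbidden partial functions. Closing under the
choice of a value gives the ladder of a node. -/
theorem functionCompactness_of_ladder (hκ : κ.IsInaccessible) (hκμ : κ ≤ μ)
    (H : ∀ (T : PkTree κ μ) (S : ∀ x : Set (Below μ), Set (x → Bool)), IsLadderSystem T S →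
      ∃ b, IsBranch T b ∧ MeetsCofinally κ b S) : FunctionCompactness κ μ := by
  classical
  rintro F hF ⟨D, hD, hDg⟩
  have hμ : ℵ₀ ≤ μ := hκ.aleph0_lt.le.trans hκμ
  have hcof := aleph0_lt_cof hκ
  have hreg : κ.ord.cof = κ := hκ.isRegular.cof_ord
  obtain ⟨e⟩ : Nonempty (Below μ × Below μ ↪ Below μ) := by
    refine exists_embedding_Below ?_
    rw [mk_prod]
    simp [mul_eq_self hμ]
  let T : PkTree κ μ :=
    { level := fun _ => univ
      nonempty := fun _ _ => univ_nonempty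
      restr_mem := fun _ _ _ _ _ _ _ => mem_univ _
      small := fun x hx => by
        simpa using hκ.isStrongPrelimit hx.2 }
  let S : ∀ x : Set (Below μ), Set (x → Bool) := fun x =>
    {η | x ∈ Pk κ univ ∧ (∀ a ∈ x, ∃ b ∈ x, ∃ h : e (a, b) ∈ x, η ⟨_, h⟩ = true) ∧
      ∀ p ∈ F, p.1 ⊆ x → ¬ ∀ i ∈ p.1, ∃ h : e (i, p.2 i) ∈ x, η ⟨_, h⟩ = true}
  have hS : IsLadderSystem T S := by
    refine ⟨fun x η hη => ⟨hη.1, mem_univ _⟩, ?_, ?_⟩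
    · refine ⟨_, hD.inter (isClub_closedUnder₂ hcof (w := ∅) ⟨empty_subset _, ?_⟩
        (s := fun a b => {e (a, b)}) fun y hy => ?_) hcof, ?_⟩
      · simpa using hκ.pos
      · refine biUnion_mem_Pk hκ.aleph0_lt.le (hy.2.trans_eq hreg.symm) fun a _ =>
          biUnion_mem_Pk hκ.aleph0_lt.le (hy.2.trans_eq hreg.symm) fun b _ => ⟨subset_univ _, ?_⟩
        simpa using hκ.nat_lt 1
      · rintro A ⟨hAD, hA, -, hAe⟩
        obtain ⟨g, hgA, hgF⟩ := hDg A hAD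
        have he : ∀ a ∈ A, ∀ b ∈ A, e (a, b) ∈ A := fun a ha b hb => hAe a ha b hb rfl
        refine ⟨fun c => decide (∃ a ∈ A, e (a, g a) = c.1), hA, fun a ha => ⟨g a, hgA ha, ?_⟩, ?_⟩
        · exact ⟨he a ha _ (hgA ha), decide_eq_true ⟨a, ha, rfl⟩⟩
        · intro p hp hpA hpe
          refine hgF p hp hpA fun i hi => ?_
          obtain ⟨h, hh⟩ := hpe i hi
          obtain ⟨a, ha, hae⟩ := of_decide_eq_true hh
          obtain ⟨rfl, h2⟩ := Prod.mk.inj (e.injective hae)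
          exact h2
    · rintro x η ⟨hx, hηx, hηF⟩ hρ
      have : Nonempty (Below μ) := by
        rw [← mk_ne_zero_iff, mk_ord_toType]
        exact (aleph0_pos.trans_le hμ).ne'
      choose! v hv hve hvη using hηx
      refine ⟨_, isClub_closedUnder hρ (w := ∅) ⟨empty_subset _, ?_⟩
        (s := fun a => {v a, e (a, v a)}) fun y hy => ?_, ?_⟩
      · simpa using aleph0_pos.trans (hρ.trans_le (Ordinal.cof_ord_le _))
      · refine mem_Pk_of_subset (union_mem_Pk (hρ.le.trans (Ordinal.cof_ord_le _))
          (image_mem_Pk hy (e := v) hv) (image_mem_Pk hy (e := fun a => e (a, v a)) hve)) ?_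
        refine iUnion₂_subset fun a ha => ?_
        rintro c (rfl | rfl)
        exacts [Or.inl ⟨a, ha, rfl⟩, Or.inr ⟨a, ha, rfl⟩]
      · rintro y ⟨hy, -, hys⟩
        refine ⟨hy.1, mem_Pk_of_subset hx hy.1, fun a ha => ⟨v a, hys a ha (Or.inl rfl),
          hys a ha (Or.inr rfl), hvη a (hy.1 ha)⟩, fun p hp hpy hpe => ?_⟩
        refine hηF p hp (hpy.trans hy.1) fun i hi => ?_
        obtain ⟨h, hh⟩ := hpe i hi
        exact ⟨hy.1 h, hh⟩
  obtain ⟨b, -, hb⟩ := H T S hS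
  -- The branch codes a total relation; any function contained in it will do.
  have hg : ∀ a, ∃ c, b (e (a, c)) = true := by
    intro a
    obtain ⟨z, _, hz, _, hz1, _⟩ := hb {a} ⟨subset_univ _, by simpa using hκ.nat_lt 1⟩
    obtain ⟨c, -, _, hc⟩ := hz1 a (hz rfl)
    exact ⟨c, hc⟩
  choose g hg using hg
  refine ⟨g, fun p hp hgp => ?_⟩
  obtain ⟨z, -, hz, -, -, hz2⟩ := hb (p.1 ∪ (fun i => e (i, p.2 i)) '' p.1)
    ⟨subset_univ _, mk_union_lt hκ (hF p hp) (mk_image_le.trans_lt (hF p hp))⟩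
  refine hz2 p hp (subset_union_left.trans hz) fun i hi => ⟨hz (Or.inr ⟨i, hi, rfl⟩), ?_⟩
  have := hg i
  rw [hgp hi] at this
  exact this

/-! ### From compactness with type omission to compactness for functions -/

theorem mk_Iio_toType (o : Ordinal.{u}) (a : o.ToType) :
    #(Iio a) = (a.toOrd : Ordinal.{u}).card :=
  Ordinal.card_typein (r := (· < · : o.ToType → o.ToType → Prop)) a |>.symm

/-- A set of size `< c` is enumerated by an initial segment of `c`. -/
theorem exists_range_Iio_eq {α : Type u} {c : Cardinal.{u}} {s : Set α} (hs : #s < c) :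
    ∃ (a : c.ord.ToType) (h : Iio a → α), (a.toOrd : Ordinal.{u}) = (#s).ord ∧ range h = s := by
  let a : c.ord.ToType := Ordinal.ToType.mk ⟨(#s).ord, ord_lt_ord.2 hs⟩
  have ha : (a.toOrd : Ordinal.{u}) = (#s).ord := by simp [a]
  have : #(Iio a) = #s := by rw [mk_Iio_toType, ha, card_ord]
  obtain ⟨f⟩ := Cardinal.eq.1 this
  refine ⟨a, fun i => f i, ha, ?_⟩
  rw [range_comp' Subtype.val f, f.range_eq_univ, image_univ, Subtype.range_coe]

/-- The function symbols of the language with the constants `C` and no other symbols. -/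
inductive ConstFunctions (C : Type u) : ℕ → Type u
  | mk (c : C) : ConstFunctions C 0

/-- The language with the constants `C` and no other symbols. -/
def constLang (C : Type u) : FirstOrder.Language.{u, u} :=
  ⟨ConstFunctions C, fun _ => PEmpty⟩

theorem card_constLang (C : Type u) : (constLang C).card = #C := by
  let f : C → (constLang C).Symbols := fun c => .inl ⟨0, .mk c⟩
  have hf : Function.Bijective f := by
    refine ⟨fun c d h => ?_, ?_⟩
    · cases h
      rfl
    · rintro (⟨_, ⟨c⟩⟩ | ⟨_, ⟨⟩⟩)
      exact ⟨c, rfl⟩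
  exact (mk_congr (Equiv.ofBijective f hf)).symm

/-- The constant `c` as a term. -/
def constTerm {C : Type u} (κ : Cardinal.{u}) (c : C) : (constLang C).Term (Var κ) :=
  .func (ConstFunctions.mk c : (constLang C).Functions 0) Fin.elim0

theorem termVars_constTerm {C : Type u} (c : C) : termVars (constTerm κ c) = ∅ := by
  simp [constTerm, termVars]

theorem constTerm_injective {C : Type u} : Function.Injective (constTerm κ : C → _) := by
  intro c d h
  cases h
  rfl

/-- The interpretation of the constant `c`. -/
def constVal {C M : Type u} [(constLang C).Structure M] (c : C) : M :=
  FirstOrder.Language.Structure.funMap (L := constLang C) (ConstFunctions.mk c : ConstFunctions C 0)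
    Fin.elim0

theorem realize_constTerm {C M : Type u} [(constLang C).Structure M] (c : C) (v : Var κ → M) :
    (constTerm κ c).realize v = constVal c := by
  simp only [constTerm, FirstOrder.Language.Term.realize, constVal]
  congr 1
  exact Subsingleton.elim _ _

/-- The structure which interprets the constants by `f`. -/
abbrev constStructure {C M : Type u} (f : C → M) : (constLang C).Structure M where
  funMap | .mk c, _ => f c
  RelMap r _ := r.elim

/-- With constants `c a` and `g a` for `a < μ`, the forbidden partial functions become sentences,
and the omitted type `{v ≠ c a | a < μ}` says that every `g a` is some `c b`. -/
theorem CompactnessWithTypeOmission.functionCompactness (hκ : κ.IsInaccessible) (hκμ : κ ≤ μ)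
    (H : CompactnessWithTypeOmission κ μ) : FunctionCompactness κ μ := by
  classical
  rintro F hF ⟨D, hD, hDg⟩
  have hμ : ℵ₀ ≤ μ := hκ.aleph0_lt.le.trans hκμ
  have hcof := aleph0_lt_cof hκ
  have hreg : κ.ord.cof = κ := hκ.isRegular.cof_ord
  have hμne : Nonempty (Below μ) := by
    rw [← mk_ne_zero_iff, mk_ord_toType]
    exact (aleph0_pos.trans_le hμ).ne'
  have hκne : Nonempty (Var κ) := by
    rw [← mk_ne_zero_iff, mk_ord_toType]
    exact hκ.ne_zero
  obtain ⟨x₀⟩ := hκne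
  obtain ⟨a₀⟩ := hμne
  let L := constLang (Below μ ⊕ Below μ)
  let c : Below μ → L.Term (Var κ) := fun a => constTerm κ (Sum.inl a)
  let g : Below μ → L.Term (Var κ) := fun a => constTerm κ (Sum.inr a)
  choose top enum _ henum using fun p : F => exists_range_Iio_eq (hF p p.2)
  let φ : F → Formula L κ := fun p =>
    .neg (.conj (top p) fun i => .eq (g (enum p i)) (c (p.1.2 (enum p i))))
  let ψ : Below μ → Formula L κ := fun a => .neg (.eq (.var x₀) (c a))
  have hφ : ∀ (p : F) (M : Type u) [L.Structure M] (v : Var κ → M), (φ p).Realize v ↔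
      ¬ ∀ i ∈ p.1.1, (constVal (Sum.inr i : Below μ ⊕ Below μ) : M) =
        constVal (Sum.inl (p.1.2 i) : Below μ ⊕ Below μ) := by
    intro p M _ v
    simp only [φ, Formula.Realize, g, c, realize_constTerm]
    conv_rhs => rw [← henum p]
    simp only [forall_mem_range]
  have hψ : ∀ a (M : Type u) [L.Structure M] (v : Var κ → M), (ψ a).Realize v ↔
      v x₀ ≠ constVal (Sum.inl a : Below μ ⊕ Below μ) := by
    intro a M _ v
    simp only [ψ, Formula.Realize, c, realize_constTerm, FirstOrder.Language.Term.realize, ne_eq]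
  have hψinj : Function.Injective ψ := by
    intro a b hab
    simp only [ψ, c, constTerm, Formula.neg.injEq, Formula.eq.injEq] at hab
    exact Sum.inl_injective (constTerm_injective hab.2)
  let T : Set (Formula L κ) := range φ
  let q : Set (Formula L κ) := range ψ
  have hTt : IsTheory T := by
    rintro _ ⟨p, rfl⟩
    simp [φ, Formula.freeVars, g, c, termVars_constTerm]
  have hqt : IsType q := by
    refine ⟨{x₀}, finite_singleton _, ?_⟩
    rintro _ ⟨a, rfl⟩
    simp [ψ, Formula.freeVars, c, termVars_constTerm, termVars]
  have happ : ∃ C, IsClub κ (T ∪ q) C ∧ ∀ x ∈ C, HasModelOmitting (x ∩ T) (x ∩ q) := by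
    have hone : ∀ ξ : Formula L κ, ξ ∈ T ∪ q → ({ξ} : Set (Formula L κ)) ∈ Pk κ (T ∪ q) :=
      fun ξ hξ => ⟨singleton_subset_iff.2 hξ, by simpa using hκ.nat_lt 1⟩
    -- A sentence of the theory may come from several forbidden functions; `s` uses one of them.
    -- Closure under `s` gives all constants in the sentence their intended values.
    let s : Formula L κ → Set (Formula L κ) := fun ξ =>
      if h : ∃ p, φ p = ξ then ψ '' (h.choose.1.1 ∪ h.choose.1.2 '' h.choose.1.1) else ∅
    have hs : ∀ ξ, s ξ ∈ Pk κ (T ∪ q) := by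
      intro ξ
      by_cases h : ∃ p, φ p = ξ
      · simp only [s, dif_pos h]
        exact ⟨image_subset_iff.2 fun a _ => Or.inr ⟨a, rfl⟩,
          mk_image_le.trans_lt
            (mk_union_lt hκ (hF _ h.choose.2) (mk_image_le.trans_lt (hF _ h.choose.2)))⟩
      · simp only [s, dif_neg h]
        exact ⟨empty_subset _, by simpa using hκ.pos⟩
    refine ⟨_, (hD.comap hκ.aleph0_lt.le hψinj fun a _ => Or.inr ⟨a, rfl⟩).inter
      (isClub_closedUnder hcof (hone (ψ a₀) (Or.inr ⟨a₀, rfl⟩)) (s := s) fun y hy =>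
        biUnion_mem_Pk hκ.aleph0_lt.le (hy.2.trans_eq hreg.symm) fun ξ _ => hs ξ) hcof, ?_⟩
    rintro X ⟨⟨-, hXD⟩, -, hXa, hXs⟩
    rw [univ_inter] at hXD
    obtain ⟨f, hfA, hfF⟩ := hDg _ hXD
    have ha₀ : a₀ ∈ ψ ⁻¹' X := hXa rfl
    -- The universe consists of the `a` for which the formula `v ≠ c a` belongs to the subtype.
    let ι : Below μ ⊕ Below μ → ψ ⁻¹' X := fun d => match d with
      | .inl a => if h : a ∈ ψ ⁻¹' X then ⟨a, h⟩ else ⟨a₀, ha₀⟩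
      | .inr a => if h : a ∈ ψ ⁻¹' X then ⟨f a, hfA h⟩ else ⟨a₀, ha₀⟩
    let sA : L.Structure (ψ ⁻¹' X) := constStructure ι
    have hι : ∀ d : Below μ ⊕ Below μ, (constVal d : ψ ⁻¹' X) = ι d := fun d => rfl
    refine ⟨ψ ⁻¹' X, ⟨⟨a₀, ha₀⟩⟩, sA, ?_, ?_⟩
    · rintro ξ ⟨hξX, hξ⟩ v
      have hξs := hXs ξ hξX
      have hξ' : ∃ p, φ p = ξ := hξ
      simp only [s, dif_pos hξ', image_subset_iff, union_subset_iff] at hξs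
      rw [← hξ'.choose_spec, hφ]
      intro hall
      refine hfF _ hξ'.choose.2 hξs.1 fun i hi => ?_
      have := hall i hi
      have hi' : i ∈ ψ ⁻¹' X := hξs.1 hi
      have hti : hξ'.choose.1.2 i ∈ ψ ⁻¹' X := hξs.2 hi
      simp only [hι, ι, dif_pos hi', dif_pos hti] at this
      exact congrArg Subtype.val this
    · rintro ⟨v, hv⟩
      have := hv _ ⟨(v x₀).2, ⟨_, rfl⟩⟩
      rw [hψ, hι] at this
      have h := (v x₀).2
      simp only [ι, dif_pos h] at this
      exact this rfl
  obtain ⟨M, hM, sM, hT, hq⟩ := H L (by simp [L, card_constLang, add_eq_self hμ]) T q hTt hqt happ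
  have hsurj : ∀ m : M, ∃ a, m = constVal (Sum.inl a : Below μ ⊕ Below μ) := by
    intro m
    by_contra! hm
    refine hq ⟨fun _ => m, ?_⟩
    rintro _ ⟨a, rfl⟩
    rw [hψ]
    exact hm a
  choose f hf using fun a => hsurj (constVal (Sum.inr a : Below μ ⊕ Below μ))
  refine ⟨f, fun p hp hfp => ?_⟩
  refine (hφ ⟨p, hp⟩ M fun _ => hM.some).1 (hT _ ⟨_, rfl⟩ _) fun i hi => ?_
  rw [hf, hfp hi]

/-! ### Counting -/

theorem aleph0_le_of_isInaccessible (hκ : κ.IsInaccessible) (hκμ : κ ≤ μ) : ℵ₀ ≤ μ :=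
  hκ.aleph0_lt.le.trans hκμ

theorem mk_arrow_le (hμ : μ = μ ^< κ) {ι V : Type u} (hι : #ι < κ) (hV : #V ≤ μ) :
    #(ι → V) ≤ μ := by
  rw [← power_def]
  refine (power_le_power_right hV).trans ?_
  conv_rhs => rw [hμ]
  exact le_powerlt μ hι

theorem mk_sigma_le_of_le (hμ : ℵ₀ ≤ μ) {ι : Type u} {β : ι → Type u} (hι : #ι ≤ μ)
    (hβ : ∀ i, #(β i) ≤ μ) : #(Σ i, β i) ≤ μ := by
  rw [mk_sigma]
  refine (sum_le_sum _ (fun _ => μ) hβ).trans ?_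
  rw [sum_const']
  exact mul_le_of_le hμ hι le_rfl

theorem mk_prod_le_of_le (hμ : ℵ₀ ≤ μ) {α β : Type u} (hα : #α ≤ μ) (hβ : #β ≤ μ) :
    #(α × β) ≤ μ := by
  rw [mk_prod, lift_id, lift_id]
  exact mul_le_of_le hμ hα hβ

theorem mk_sum_le_of_le (hμ : ℵ₀ ≤ μ) {α β : Type u} (hα : #α ≤ μ) (hβ : #β ≤ μ) :
    #(α ⊕ β) ≤ μ := by
  rw [mk_sum, lift_id, lift_id]
  exact add_le_of_le hμ hα hβ

theorem mk_small_sets_le (hκ : κ.IsInaccessible) (hκμ : κ ≤ μ) (hμ : μ = μ ^< κ) {α : Type u}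
    (hα : #α ≤ μ) : #{z : Set α // #z < κ} ≤ μ := by
  have hμ₀ := aleph0_le_of_isInaccessible hκ hκμ
  let f : (Σ a : Var κ, Iio a → α) → Set α := fun p => range p.2
  have hf : ∀ z : {z : Set α // #z < κ}, ∃ p, f p = z.1 := by
    intro z
    obtain ⟨a, h, -, hz⟩ := exists_range_Iio_eq z.2
    exact ⟨⟨a, h⟩, hz⟩
  choose g hg using hf
  refine (mk_le_of_injective (f := g) fun y z hyz => Subtype.ext ?_).trans
    (mk_sigma_le_of_le hμ₀ (by simpa using hκμ) fun a => mk_arrow_le hμ ?_ hα)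
  · rw [← hg, hyz, hg]
  · simpa using mk_Iio_lt a (by simp)

theorem mk_setOf_toOrd_lt_le (o : Ordinal.{u}) :
    #{b : Below μ | (b.toOrd : Ordinal.{u}) < o} ≤ o.card := by
  rw [← mk_toType]
  refine mk_le_of_injective (f := fun b => Ordinal.ToType.mk ⟨b.1.toOrd, b.2⟩) fun a b h => ?_
  have := Ordinal.ToType.mk.injective h
  exact Subtype.ext (Ordinal.ToType.mk.symm.injective (Subtype.ext (Subtype.mk.inj this)))

theorem le_mk_setOf_toOrd_lt {o : Ordinal.{u}} (ho : o ≤ μ.ord) :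
    o.card ≤ #{b : Below μ | (b.toOrd : Ordinal.{u}) < o} := by
  rw [← mk_toType]
  refine mk_le_of_injective (f := fun b : o.ToType => (⟨Ordinal.ToType.mk ⟨b.toOrd,
    mem_Iio.2 (b.toOrd.2.trans_le ho)⟩, by
      rw [mem_ofPred_eq, Ordinal.ToType.toOrd, OrderIso.symm_apply_apply]
      exact b.toOrd.2⟩ :
    {b : Below μ | (b.toOrd : Ordinal.{u}) < o})) fun a b h => ?_
  have := Ordinal.ToType.mk.injective (congrArg Subtype.val h)
  exact Ordinal.ToType.mk.symm.injective (Subtype.ext (Subtype.mk.inj this))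

/-! ### From compactness for functions to branches -/

/-- The elements of `P_κ μ`, as a type. -/
abbrev SmallSet (κ μ : Cardinal.{u}) : Type u := {z : Set (Below μ) // #z < κ}

/-- If `A` is closed under cardinal predecessors below `κ`, then `A ∩ κ` is the cardinal
`|A ∩ κ|`. -/
theorem mem_iff_lt_cardBelow (hκ : κ.IsInaccessible) (hκμ : κ ≤ μ) {A : Set (Below μ)}
    (hA : ∀ a ∈ A, ∀ b : Below μ, (a.toOrd : Ordinal.{u}) < κ.ord →
      (b.toOrd : Ordinal.{u}).card ≤ (a.toOrd : Ordinal.{u}).card → b ∈ A)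
    (a : Below μ) (ha : (a.toOrd : Ordinal.{u}) < κ.ord) :
    a ∈ A ↔ (a.toOrd : Ordinal.{u}) < (cardBelow κ A).ord := by
  constructor
  · intro haA
    have h1 : Order.succ (a.toOrd : Ordinal.{u}).card < κ :=
      hκ.isSuccLimit.succ_lt (lt_ord.1 ha)
    rw [lt_ord]
    refine (Order.lt_succ _).trans_le ?_
    have h2 := le_mk_setOf_toOrd_lt (μ := μ) (o := (Order.succ (a.toOrd : Ordinal.{u}).card).ord)
      (ord_le_ord.2 (h1.le.trans hκμ))
    rw [card_ord] at h2
    refine h2.trans (mk_le_mk_of_subset fun b hb => ⟨hA a haA b ha ?_, hb.trans (ord_lt_ord.2 h1)⟩)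
    rwa [mem_ofPred_eq, lt_ord, Order.lt_succ_iff] at hb
  · intro hρ
    by_contra haA
    refine (lt_ord.1 hρ).not_ge (le_trans (mk_le_mk_of_subset ?_) (mk_setOf_toOrd_lt_le _))
    rintro b ⟨hbA, hb⟩
    by_contra hab
    exact haA (hA b hbA a hb (Ordinal.card_le_card (not_lt.1 hab)))

/-- The approximations to a branch which meets the ladder system `S` club often. The restriction of
`b` to `A` is a node of the ladder system, the predicate `q` says which ordinals are smaller than
the cofinality of `ρ = |A ∩ κ|`, and `E` is a club in `P_ρ A` as in the definition of a ladder
system, if `ρ` has uncountable cofinality. The element of this club above `z` is `f z '' Iio (β z)`.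
If `cf ρ ≤ δ`, then the sequence `s δ` of length `δ` is cofinal in `ρ`. -/
structure IsLadderApprox (κ : Cardinal.{u}) {μ : Cardinal.{u}}
    (S : ∀ x : Set (Below μ), Set (x → Bool)) (A : Set (Below μ))
    (β : SmallSet κ μ → Below μ) (f : SmallSet κ μ → Below μ → Below μ)
    (s : Var κ → Var κ → Below μ) (b : Below μ → Prop) (E : SmallSet κ μ → Prop)
    (q : Var κ → Prop) : Prop where
  node : ∃ η ∈ S A, (∀ a : A, b a ↔ η a = true) ∧ (ℵ₀ < (cardBelow κ A).ord.cof →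
    ∀ z, E z → ∃ h : z.1 ⊆ A, restr h η ∈ S z.1)
  q_iff : ∀ δ, q δ ↔ (δ.toOrd : Ordinal.{u}) < (cardBelow κ A).ord.cof.ord
  club : ℵ₀ < (cardBelow κ A).ord.cof → IsClub (cardBelow κ A) A {z | ∃ hz, E ⟨z, hz⟩}
  enum : ℵ₀ < (cardBelow κ A).ord.cof → ∀ z : SmallSet κ μ, z.1 ∈ Pk (cardBelow κ A) A →
    ((β z).toOrd : Ordinal.{u}) < κ.ord ∧ z.1 ⊆ f z '' Iio (β z) ∧
      ∃ hz, E ⟨f z '' Iio (β z), hz⟩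
  bound : ∀ δ γ, ((s δ γ).toOrd : Ordinal.{u}) < κ.ord
  cofinal : ∀ δ, ¬ q δ → ∀ a ∈ A, (a.toOrd : Ordinal.{u}) < κ.ord → ∃ γ < δ, a ≤ s δ γ

theorem exists_cofinal_sequence {ρ : Cardinal.{u}} (hρ : ρ ≠ 0) {δ : Var κ}
    (hδ : ρ.ord.cof.ord ≤ δ.toOrd) :
    ∃ t : Var κ → ρ.ord.ToType, ∀ a, ∃ γ < δ, a ≤ t γ := by
  obtain ⟨C, hC, hCc⟩ := Order.exists_cof_eq (α := ρ.ord.ToType)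
  have hne : Nonempty ρ.ord.ToType := by
    rw [← mk_ne_zero_iff, mk_ord_toType]
    exact hρ
  rw [Ordinal.cof_toType] at hCc
  have hle : #C ≤ #(Iio δ) := by
    rw [hCc, mk_Iio_toType, ← ord_le]
    exact hδ
  obtain ⟨i⟩ := hle
  refine ⟨Function.extend (fun c => (i c : Var κ)) (fun c => (c : ρ.ord.ToType))
    (fun _ => hne.some), fun a => ?_⟩
  obtain ⟨c, hc, hac⟩ := hC a
  refine ⟨i ⟨c, hc⟩, (i ⟨c, hc⟩).2, ?_⟩
  rw [Function.Injective.extend_apply (f := fun c => (i c : Var κ))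
    (Subtype.val_injective.comp i.injective)]
  exact hac

/-- Every node of the ladder system at a set `A` such that `A ∩ κ` is a nonzero cardinal gives an
approximation. Values which are not subject to a condition are set to `a₀`, to keep them in `A`. -/
theorem exists_isLadderApprox (hκμ : κ ≤ μ) {T : PkTree κ μ}
    {S : ∀ x : Set (Below μ), Set (x → Bool)} (hS : IsLadderSystem T S) {A : Set (Below μ)}
    (hA : A ∈ Pk κ univ) (hSA : (S A).Nonempty) {a₀ : Below μ} (ha₀ : a₀ ∈ A)
    (ha₀κ : (a₀.toOrd : Ordinal.{u}) < κ.ord)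
    (hAκ : ∀ a : Below μ, (a.toOrd : Ordinal.{u}) < κ.ord →
      (a ∈ A ↔ (a.toOrd : Ordinal.{u}) < (cardBelow κ A).ord)) :
    ∃ β f s b E q, (∀ z, β z ∈ A) ∧ (∀ z γ, f z γ ∈ A) ∧ (∀ δ γ, s δ γ ∈ A) ∧
      IsLadderApprox κ S A β f s b E q := by
  classical
  obtain ⟨η, hη⟩ := hSA
  set ρ := cardBelow κ A
  have hρκ : ρ < κ := (mk_le_mk_of_subset fun a ha => ha.1).trans_lt hA.2
  have hρ0 : ρ ≠ 0 := by
    intro h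
    have := (hAκ a₀ ha₀κ).1 ha₀
    simp [h] at this
  have hE : ∃ E : Set (Set (Below μ)), ℵ₀ < ρ.ord.cof → IsClub ρ A E ∧
      ∀ y ∈ E, ∃ h : y ⊆ A, restr h η ∈ S y := by
    by_cases hcof : ℵ₀ < ρ.ord.cof
    · obtain ⟨E, hE⟩ := hS.ladder A η hη hcof
      exact ⟨E, fun _ => hE⟩
    · exact ⟨∅, fun h => (hcof h).elim⟩
  obtain ⟨E, hE⟩ := hE
  have hz : ∀ z : SmallSet κ μ, ∃ (c : Below μ) (f : Below μ → Below μ), c ∈ A ∧ (∀ γ, f γ ∈ A) ∧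
      (ℵ₀ < ρ.ord.cof → z.1 ∈ Pk ρ A → (c.toOrd : Ordinal.{u}) < κ.ord ∧ z.1 ⊆ f '' Iio c ∧
        ∃ _ : #(f '' Iio c) < κ, f '' Iio c ∈ E) := by
    intro z
    by_cases hc : ℵ₀ < ρ.ord.cof ∧ z.1 ∈ Pk ρ A
    · obtain ⟨y, hy, hzy⟩ := (hE hc.1).1.cofinal _ hc.2
      have hyρ := (hE hc.1).1.subset hy
      obtain ⟨c, h, hcy, hh⟩ := exists_range_Iio_eq (hyρ.2.trans (hρκ.trans_le hκμ))
      have hcρ : (c.toOrd : Ordinal.{u}) < ρ.ord := by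
        rw [hcy]
        exact ord_lt_ord.2 hyρ.2
      have hcκ := hcρ.trans (ord_lt_ord.2 hρκ)
      have him : (fun γ => if hγ : γ ∈ Iio c then h ⟨γ, hγ⟩ else a₀) '' Iio c = y := by
        rw [← hh]
        ext a
        constructor
        · rintro ⟨γ, hγ, rfl⟩
          exact ⟨⟨γ, hγ⟩, by simp only [dif_pos hγ]⟩
        · rintro ⟨γ, rfl⟩
          exact ⟨γ.1, γ.2, by simp only [dif_pos γ.2]⟩
      refine ⟨c, fun γ => if hγ : γ ∈ Iio c then h ⟨γ, hγ⟩ else a₀, (hAκ c hcκ).2 hcρ,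
        fun γ => ?_, fun _ _ => ?_⟩
      · by_cases hγ : γ ∈ Iio c
        · simp only [dif_pos hγ]
          exact hyρ.1 (hh ▸ ⟨_, rfl⟩)
        · simp only [dif_neg hγ]
          exact ha₀
      · rw [him]
        exact ⟨hcκ, hzy, hyρ.2.trans hρκ, hy⟩
    · exact ⟨a₀, fun _ => a₀, ha₀, fun _ => ha₀, fun h1 h2 => (hc ⟨h1, h2⟩).elim⟩
  choose β f hβ hf hβf using hz
  have hs : ∀ δ : Var κ, ∃ s : Var κ → Below μ, ∀ γ, (s γ ∈ A ∧
      ((s γ).toOrd : Ordinal.{u}) < κ.ord) ∧ (¬ (δ.toOrd : Ordinal.{u}) < ρ.ord.cof.ord →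
        ∀ a ∈ A, (a.toOrd : Ordinal.{u}) < κ.ord → ∃ γ < δ, a ≤ s γ) := by
    intro δ
    by_cases hδ : (δ.toOrd : Ordinal.{u}) < ρ.ord.cof.ord
    · exact ⟨fun _ => a₀, fun _ => ⟨⟨ha₀, ha₀κ⟩, fun h => (h hδ).elim⟩⟩
    · obtain ⟨t, ht⟩ := exists_cofinal_sequence hρ0 (not_lt.1 hδ)
      have htκ : ∀ γ, ((t γ).toOrd : Ordinal.{u}) < κ.ord := fun γ =>
        lt_trans (t γ).toOrd.2 (ord_lt_ord.2 hρκ)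
      let s : Var κ → Below μ := fun γ => Ordinal.ToType.mk ⟨(t γ).toOrd,
        mem_Iio.2 ((htκ γ).trans_le (ord_le_ord.2 hκμ))⟩
      have hst : ∀ γ, ((s γ).toOrd : Ordinal.{u}) = (t γ).toOrd := fun γ => by simp [s]
      refine ⟨s, fun γ => ⟨⟨?_, ?_⟩, fun _ a ha haκ => ?_⟩⟩
      · rw [hAκ _ ((hst γ).trans_lt (htκ γ)), hst]
        exact (t γ).toOrd.2
      · rw [hst]
        exact htκ γ
      · have haρ := (hAκ a haκ).1 ha
        obtain ⟨γ, hγ, hle⟩ := ht (Ordinal.ToType.mk ⟨a.toOrd, haρ⟩)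
        refine ⟨γ, hγ, ?_⟩
        rw [← Ordinal.ToType.mk.symm.le_iff_le] at hle ⊢
        rw [← Subtype.coe_le_coe] at hle ⊢
        change (a.toOrd : Ordinal.{u}) ≤ (s γ).toOrd
        rw [hst]
        simpa using hle
  choose s hs using hs
  refine ⟨β, f, s, fun a => ∃ h : a ∈ A, η ⟨a, h⟩ = true, fun z => z.1 ∈ E,
    fun δ => (δ.toOrd : Ordinal.{u}) < ρ.ord.cof.ord, hβ, hf, fun δ γ => (hs δ γ).1.1, ?_⟩
  refine ⟨⟨η, hη, fun a => ⟨fun h => h.2, fun h => ⟨a.2, h⟩⟩, fun h z hz => (hE h).2 _ hz⟩,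
    fun δ => Iff.rfl, fun h => ?_, fun h z => hβf z h, fun δ γ => (hs δ γ).1.2,
    fun δ hδ => (hs δ δ).2 hδ⟩
  convert (hE h).1 using 1
  ext z
  exact ⟨fun hz => hz.2, fun hz => ⟨((hE h).1.subset hz).2.trans hρκ, hz⟩⟩

/-- A limit of ladder approximations: on any small sets of arguments it looks like an approximation
which belongs to some `A` above a given small set. -/
theorem exists_limit_ladderApprox (hFC : FunctionCompactness κ μ) (hκ : κ.IsInaccessible)
    (hκμ : κ ≤ μ) (hμ : μ = μ ^< κ) {T : PkTree κ μ} {S : ∀ x : Set (Below μ), Set (x → Bool)}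
    (hS : IsLadderSystem T S) :
    ∃ (β : SmallSet κ μ → Below μ) (f : SmallSet κ μ → Below μ → Below μ)
      (s : Var κ → Var κ → Below μ) (b : Below μ → Prop) (E : SmallSet κ μ → Prop)
      (q : Var κ → Prop),
      ∀ (Jβ : Set (SmallSet κ μ)) (Jf : Set (SmallSet κ μ × Below μ)) (Js : Set (Var κ × Var κ))
        (Jb : Set (Below μ)) (JE : Set (SmallSet κ μ)) (Jq : Set (Var κ)) (w : Set (Below μ)),
        #Jβ < κ → #Jf < κ → #Js < κ → #Jb < κ → #JE < κ → #Jq < κ → #w < κ →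
        ∃ A β' f' s' b' E' q', w ⊆ A ∧ IsLadderApprox κ S A β' f' s' b' E' q' ∧
          (∀ z ∈ Jβ, β z = β' z) ∧ (∀ p ∈ Jf, f p.1 p.2 = f' p.1 p.2) ∧
          (∀ p ∈ Js, s p.1 p.2 = s' p.1 p.2) ∧ (∀ a ∈ Jb, b a ↔ b' a) ∧
          (∀ z ∈ JE, E z ↔ E' z) ∧ ∀ δ ∈ Jq, q δ ↔ q' δ := by
  have hμ₀ := aleph0_le_of_isInaccessible hκ hκμ
  have hcof := aleph0_lt_cof hκ
  have hreg : κ.ord.cof = κ := hκ.isRegular.cof_ord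
  have hB : #(Below μ) ≤ μ := by simp
  have hV : #(Var κ) ≤ μ := by simpa using hκμ
  have hZ : #(SmallSet κ μ) ≤ μ := mk_small_sets_le hκ hκμ hμ hB
  have hκ0 : (0 : Ordinal.{u}) < κ.ord := by
    rw [← ord_zero]
    exact ord_lt_ord.2 hκ.pos
  let a₀ : Below μ := Ordinal.ToType.mk ⟨0, hκ0.trans_le (ord_le_ord.2 hκμ)⟩
  have ha₀ : (a₀.toOrd : Ordinal.{u}) = 0 := by simp [a₀]
  have : Nonempty (Below μ) := ⟨a₀⟩
  obtain ⟨g, h, hgh⟩ := hFC.exists_limit hκ hκμ (V := Below μ)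
    (I₁ := SmallSet κ μ ⊕ ((SmallSet κ μ × Below μ) ⊕ (Var κ × Var κ)))
    (I₂ := Below μ ⊕ (SmallSet κ μ ⊕ Var κ))
    (mk_sum_le_of_le hμ₀ hZ (mk_sum_le_of_le hμ₀ (mk_prod_le_of_le hμ₀ hZ hB)
      (mk_prod_le_of_le hμ₀ hV hV)))
    (mk_sum_le_of_le hμ₀ hB (mk_sum_le_of_le hμ₀ hZ hV)) hB
    (fun A g h => IsLadderApprox κ S A (fun z => g (.inl z)) (fun z γ => g (.inr (.inl (z, γ))))
      (fun δ γ => g (.inr (.inr (δ, γ)))) (fun a => h (.inl a)) (fun z => h (.inr (.inl z)))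
      fun δ => h (.inr (.inr δ))) (by
    obtain ⟨C, hC, hCS⟩ := hS.club
    -- Closure under `s` makes `A ∩ κ` a cardinal.
    let s : Below μ → Set (Below μ) := fun a => {b | (a.toOrd : Ordinal.{u}) < κ.ord ∧
      (b.toOrd : Ordinal.{u}).card ≤ (a.toOrd : Ordinal.{u}).card}
    have hs : ∀ a, s a ∈ Pk κ univ := by
      intro a
      refine ⟨subset_univ _, ?_⟩
      by_cases ha : (a.toOrd : Ordinal.{u}) < κ.ord
      · refine lt_of_le_of_lt (mk_le_mk_of_subset fun b hb => ?_) ((mk_setOf_toOrd_lt_le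
          (μ := μ) (Order.succ (a.toOrd : Ordinal.{u}).card).ord).trans_lt ?_)
        · exact lt_ord.2 (Order.lt_succ_iff.2 hb.2)
        · rw [card_ord]
          exact hκ.isSuccLimit.succ_lt (lt_ord.1 ha)
      · have : s a = ∅ := by
          ext b
          simp [s, ha]
        rw [this]
        simpa using hκ.pos
    refine ⟨_, hC.inter (isClub_closedUnder hcof (w := {a₀}) ⟨subset_univ _,
      by simpa using hκ.nat_lt 1⟩ (s := s) fun y hy => biUnion_mem_Pk hκ.aleph0_lt.le
        (hy.2.trans_eq hreg.symm) fun a _ => hs a) hcof, ?_⟩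
    rintro A ⟨hAC, hA, hAa₀, hAs⟩
    obtain ⟨β, f, s, b, E, q, h1, h2, h3, h4⟩ := exists_isLadderApprox hκμ hS hA (hCS A hAC)
      (hAa₀ rfl) (ha₀.trans_lt hκ0) (mem_iff_lt_cardBelow hκ hκμ
        fun a ha b haκ hb => hAs a ha ⟨haκ, hb⟩)
    refine ⟨Sum.elim β (Sum.elim (fun p => f p.1 p.2) fun p => s p.1 p.2),
      Sum.elim b (Sum.elim E q), ?_, h4⟩
    rintro (z | ⟨z, γ⟩ | ⟨δ, γ⟩)
    exacts [h1 z, h2 z γ, h3 δ γ])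
  refine ⟨fun z => g (.inl z), fun z γ => g (.inr (.inl (z, γ))),
      fun δ γ => g (.inr (.inr (δ, γ))), fun a => h (.inl a), fun z => h (.inr (.inl z)),
      fun δ => h (.inr (.inr δ)), fun Jβ Jf Js Jb JE Jq w h1 h2 h3 h4 h5 h6 h7 => ?_⟩
  obtain ⟨A, g', h', hw, hG, hg, hh⟩ := hgh
    (.inl '' Jβ ∪ ((fun p => .inr (.inl p)) '' Jf ∪ (fun p => .inr (.inr p)) '' Js))
    (.inl '' Jb ∪ ((fun p => .inr (.inl p)) '' JE ∪ (fun p => .inr (.inr p)) '' Jq)) w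
    (mk_union_lt hκ (mk_image_le.trans_lt h1)
      (mk_union_lt hκ (mk_image_le.trans_lt h2) (mk_image_le.trans_lt h3)))
    (mk_union_lt hκ (mk_image_le.trans_lt h4)
      (mk_union_lt hκ (mk_image_le.trans_lt h5) (mk_image_le.trans_lt h6))) h7
  exact ⟨A, _, _, _, _, _, _, hw, hG, fun z hz => hg (Or.inl ⟨z, hz, rfl⟩),
    fun p hp => hg (Or.inr (Or.inl ⟨p, hp, rfl⟩)), fun p hp => hg (Or.inr (Or.inr ⟨p, hp, rfl⟩)),
    fun a ha => hh _ (Or.inl ⟨a, ha, rfl⟩), fun z hz => hh _ (Or.inr (Or.inl ⟨z, hz, rfl⟩)),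
    fun δ hδ => hh _ (Or.inr (Or.inr ⟨δ, hδ, rfl⟩))⟩

theorem branchRestr_eq_restr {b : Below μ → Prop} {x A : Set (Below μ)} (hx : x ⊆ A)
    {η : A → Bool} (h : ∀ a (ha : a ∈ x), b a ↔ η ⟨a, hx ha⟩ = true) :
    branchRestr (fun a => @decide (b a) (Classical.propDecidable _)) x = restr hx η := by
  funext a
  rw [branchRestr, restr, Bool.eq_iff_iff, ← h a a.2]
  simp

/-- In the limit, `κ` takes the place of `|A ∩ κ|`: its regularity makes the ladder of the limit a
club in `P_κ μ`. -/
theorem FunctionCompactness.exists_branch (hFC : FunctionCompactness κ μ) (hκ : κ.IsInaccessible)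
    (hκμ : κ ≤ μ) (hμ : μ = μ ^< κ) (T : PkTree κ μ) (S : ∀ x : Set (Below μ), Set (x → Bool))
    (hS : IsLadderSystem T S) : ∃ b, IsBranch T b ∧ MeetsClubOften κ b S := by
  classical
  have hreg : κ.ord.cof = κ := hκ.isRegular.cof_ord
  obtain ⟨β, f, s, b, E, q, H⟩ := exists_limit_ladderApprox hFC hκ hκμ hμ hS
  have he : ∀ {α : Type u}, #(∅ : Set α) < κ := by
    intro α
    simpa using hκ.pos
  have h1 : ∀ {α : Type u} (a : α), #({a} : Set α) < κ := by
    intro α a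
    simpa using hκ.nat_lt 1
  have hIio : ∀ {ν : Cardinal.{u}} (a : ν.ord.ToType), (a.toOrd : Ordinal.{u}) < κ.ord →
      #(Iio a) < κ := by
    intro ν a ha
    rw [mk_Iio_toType]
    exact lt_ord.1 ha
  -- All ordinals below `κ` are below the cofinality: a short sequence in `κ` is bounded.
  have hq : ∀ δ, q δ := by
    intro δ
    by_contra hδ
    have hsκ : ∀ γ, ((s δ γ).toOrd : Ordinal.{u}) < κ.ord := by
      intro γ
      obtain ⟨A, β', f', s', b', E', q', -, hA, -, -, hs, -⟩ := H ∅ ∅ {(δ, γ)} ∅ ∅ ∅ ∅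
        he he (h1 _) he he he he
      rw [hs _ rfl]
      exact hA.bound δ γ
    have hsup : ⨆ γ : Iio δ, ((s δ γ).toOrd : Ordinal.{u}) + 1 < κ.ord := by
      refine Ordinal.iSup_add_one_lt_of_lt_cof ?_ fun γ => hsκ γ
      rw [hreg]
      exact hIio δ δ.toOrd.2
    let a : Below μ := Ordinal.ToType.mk ⟨_, mem_Iio.2 (hsup.trans_le (ord_le_ord.2 hκμ))⟩
    have ha : (a.toOrd : Ordinal.{u}) = ⨆ γ : Iio δ, ((s δ γ).toOrd : Ordinal.{u}) + 1 := by
      simp [a]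
    obtain ⟨A, β', f', s', b', E', q', hw, hA, -, -, hs, -, -, hq⟩ := H ∅ ∅
      ((fun γ => (δ, γ)) '' Iio δ) ∅ ∅ {δ} {a} he he
      (mk_image_le.trans_lt (hIio δ δ.toOrd.2)) he he (h1 _) (h1 _)
    rw [hq δ rfl] at hδ
    obtain ⟨γ, hγ, haγ⟩ := hA.cofinal δ hδ a (hw rfl) (ha.trans_lt hsup)
    rw [← hs (δ, γ) ⟨γ, hγ, rfl⟩, ← Ordinal.ToType.mk.symm.le_iff_le, ← Subtype.coe_le_coe] at haγ
    have hlt : ((s δ γ).toOrd : Ordinal.{u}) < a.toOrd := by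
      rw [ha]
      exact Ordinal.lt_iSup_add_one (fun γ : Iio δ => ((s δ γ).toOrd : Ordinal.{u})) ⟨γ, hγ⟩
    exact absurd haγ hlt.not_ge
  have hω : Ordinal.omega0 < κ.ord := by
    rw [← ord_aleph0]
    exact ord_lt_ord.2 hκ.aleph0_lt
  let ω : Var κ := Ordinal.ToType.mk ⟨Ordinal.omega0, hω⟩
  have hcof : ∀ {A β' f' s' b' E'} {q' : Var κ → Prop}, IsLadderApprox κ S A β' f' s' b' E' q' →
      (∀ δ ∈ ({ω} : Set (Var κ)), q δ ↔ q' δ) → ℵ₀ < (cardBelow κ A).ord.cof := by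
    intro A β' f' s' b' E' q' hA hq'
    have := (hA.q_iff ω).1 ((hq' ω rfl).1 (hq ω))
    have hωω : (ω.toOrd : Ordinal.{u}) = Cardinal.ord ℵ₀ := by simp [ω]
    rwa [hωω, ord_lt_ord] at this
  refine ⟨fun a => decide (b a), fun x hx => ?_, {z | ∃ hz, E ⟨z, hz⟩}, ?_, ?_⟩
  · obtain ⟨A, β', f', s', b', E', q', hw, hA, -, -, -, hb, -⟩ := H ∅ ∅ ∅ x ∅ ∅ x
      he he he hx.2 he he hx.2
    obtain ⟨η, hη, hηb, -⟩ := hA.node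
    rw [branchRestr_eq_restr hw fun a ha => (hb a ha).trans (hηb ⟨a, hw ha⟩)]
    exact T.restr_mem x hx A (hS.subset A η hη).1 hw η (hS.subset A η hη).2
  · refine ⟨fun z hz => ⟨subset_univ _, hz.1⟩, fun x hx => ?_, fun o t ho0 ho ht hm => ?_⟩
    · -- If `A` contains the ordinals of size at most `|x|`, then `|x| < |A ∩ κ|`.
      let w : Set (Below μ) := x ∪ {a | (a.toOrd : Ordinal.{u}) < (Order.succ #x).ord}
      have hsucc : Order.succ #x < κ := hκ.isSuccLimit.succ_lt hx.2
      have hw : #w < κ := by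
        refine mk_union_lt hκ hx.2 ((mk_setOf_toOrd_lt_le _).trans_lt ?_)
        rwa [card_ord]
      have hwA : ∀ A : Set (Below μ), w ⊆ A → x ∈ Pk (cardBelow κ A) A := by
        intro A hA
        refine ⟨subset_union_left.trans hA, (Order.lt_succ #x).trans_le ?_⟩
        have := le_mk_setOf_toOrd_lt (μ := μ) (o := (Order.succ #x).ord)
          (ord_le_ord.2 (hsucc.le.trans hκμ))
        rw [card_ord] at this
        exact this.trans (mk_le_mk_of_subset fun a ha =>
          ⟨hA (Or.inr ha), lt_trans ha (ord_lt_ord.2 hsucc)⟩)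
      let z : SmallSet κ μ := ⟨x, hx.2⟩
      -- Only after the length `β z` is known to be `< κ` is the set of its predecessors small
      -- enough to be passed to `H`.
      have hβ : ((β z).toOrd : Ordinal.{u}) < κ.ord := by
        obtain ⟨A, β', f', s', b', E', q', hw, hA, hβ, -, -, -, -, hq'⟩ := H {z} ∅ ∅ ∅ ∅ {ω} w
          (h1 _) he he he he (h1 _) hw
        rw [hβ z rfl]
        exact (hA.enum (hcof hA hq') z (hwA A hw)).1
      have hsmall : #(f z '' Iio (β z)) < κ := mk_image_le.trans_lt (hIio _ hβ)
      obtain ⟨A, β', f', s', b', E', q', hw, hA, hβ', hf, -, -, hE, hq'⟩ := H {z}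
        ((fun γ => (z, γ)) '' Iio (β z)) ∅ ∅ {⟨_, hsmall⟩} {ω} w
        (h1 _) (mk_image_le.trans_lt (hIio _ hβ)) he he (h1 _) (h1 _) hw
      obtain ⟨-, hzf, hfE⟩ := hA.enum (hcof hA hq') z (hwA A hw)
      have him : f z '' Iio (β z) = f' z '' Iio (β' z) := by
        rw [← hβ' z rfl]
        exact image_congr fun γ hγ => hf (z, γ) ⟨γ, hγ, rfl⟩
      refine ⟨f z '' Iio (β z), ⟨hsmall, ?_⟩, ?_⟩
      · rw [hE _ rfl]
        simp only [him]
        exact hfE.2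
      · rw [him]
        exact hzf
    · have hoκ : o < κ.ord := by rwa [hreg] at ho
      have hU : (⋃ i ∈ Iio o, t i) ∈ Pk κ (univ : Set (Below μ)) :=
        iUnion_Iio_mem_Pk hκ.aleph0_lt.le ho fun i hi => ⟨subset_univ _, (ht i hi).1⟩
      let t' : o.ToType → SmallSet κ μ := fun i => ⟨t i.toOrd, (ht _ i.toOrd.2).1⟩
      let δ : Var κ := Ordinal.ToType.mk ⟨o, hoκ⟩
      obtain ⟨A, β', f', s', b', E', q', -, hA, -, -, -, -, hE, hq'⟩ := H ∅ ∅ ∅ ∅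
        (range t' ∪ {⟨_, hU.2⟩}) ({ω} ∪ {δ}) ∅ he he he he
        (mk_union_lt hκ (mk_range_le.trans_lt (by rw [mk_toType]; exact lt_ord.1 hoκ)) (h1 _))
        (mk_union_lt hκ (h1 _) (h1 _)) he
      have hδ := (hA.q_iff δ).1 ((hq' δ (Or.inr rfl)).1 (hq δ))
      have hδo : (δ.toOrd : Ordinal.{u}) = o := by simp [δ]
      rw [hδo] at hδ
      obtain ⟨hz, hEz⟩ := (hA.club (hcof hA fun δ hδ => hq' δ (Or.inl hδ))).closed o t ho0 hδ
        (fun i hi => ⟨(ht i hi).1, by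
          refine (hE ⟨t i, (ht i hi).1⟩ (Or.inl ⟨Ordinal.ToType.mk ⟨i, hi⟩, ?_⟩)).1 (ht i hi).2
          simp [t']⟩) hm
      exact ⟨hU.2, (hE _ (Or.inr rfl)).2 hEz⟩
  · rintro z ⟨hz, hEz⟩
    obtain ⟨A, β', f', s', b', E', q', -, hA, -, -, -, hb, hE, hq'⟩ := H ∅ ∅ ∅ z {⟨z, hz⟩} {ω} ∅
      he he he hz (h1 _) (h1 _) he
    obtain ⟨η, -, hηb, hηS⟩ := hA.node
    obtain ⟨h, hS⟩ := hηS (hcof hA hq') ⟨z, hz⟩ ((hE _ rfl).1 hEz)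
    rw [branchRestr_eq_restr h fun a ha => (hb a ha).trans (hηb ⟨a, h ha⟩)]
    exact hS

/-! ### Syntax: free variables and the number of formulas -/

variable {L : FirstOrder.Language.{u, u}}

theorem realize_term_congr {α M : Type u} [L.Structure M] {v w : α → M} (t : L.Term α)
    (h : ∀ x ∈ termVars t, v x = w x) : t.realize v = t.realize w := by
  induction t with
  | var x => exact h x rfl
  | func f ts ih =>
    simp only [FirstOrder.Language.Term.realize]
    congr 1
    funext i
    exact ih i fun x hx => h x (mem_iUnion.2 ⟨i, hx⟩)

theorem Formula.realize_congr {M : Type u} [L.Structure M] (φ : Formula L κ) :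
    ∀ {v w : Var κ → M}, (∀ x ∈ φ.freeVars, v x = w x) → (φ.Realize v ↔ φ.Realize w) := by
  classical
  induction φ with
  | eq s t =>
    intro v w h
    simp only [Formula.Realize]
    rw [realize_term_congr s fun x hx => h x (Or.inl hx),
      realize_term_congr t fun x hx => h x (Or.inr hx)]
  | rel R ts =>
    intro v w h
    simp only [Formula.Realize]
    have : (fun i => (ts i).realize v) = fun i => (ts i).realize w := by
      funext i
      exact realize_term_congr _ fun x hx => h x (mem_iUnion.2 ⟨i, hx⟩)
    rw [this]
  | neg φ ih =>
    intro v w h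
    exact not_congr (ih h)
  | conj a φ ih =>
    intro v w h
    exact forall_congr' fun i => ih i fun x hx => h x (mem_iUnion.2 ⟨i, hx⟩)
  | ex V hV φ ih =>
    have key : ∀ {v w : Var κ → M}, (∀ x ∈ (Formula.ex V hV φ).freeVars, v x = w x) →
        (Formula.ex V hV φ).Realize v → (Formula.ex V hV φ).Realize w := by
      rintro v w h ⟨u, hu, hφ⟩
      refine ⟨fun x => if x ∈ V then u x else w x, fun x hx => if_neg hx, (ih fun x hx => ?_).1 hφ⟩
      by_cases hxV : x ∈ V
      · simp only [if_pos hxV]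
      · simp only [if_neg hxV]
        rw [hu x hxV, h x ⟨hx, hxV⟩]
    exact fun {v w} h => ⟨key h, key fun x hx => (h x hx).symm⟩

theorem finite_termVars {α : Type u} (t : L.Term α) : (termVars t).Finite := by
  induction t with
  | var x => exact finite_singleton x
  | func f ts ih => exact finite_iUnion ih

theorem mk_freeVars_lt (hκ : κ.IsInaccessible) (φ : Formula L κ) : #φ.freeVars < κ := by
  have ht : ∀ t : L.Term (Var κ), #(termVars t) < κ := fun t =>
    (lt_aleph0_iff_set_finite.2 (finite_termVars t)).trans hκ.aleph0_lt
  induction φ with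
  | eq s t => exact mk_union_lt hκ (ht s) (ht t)
  | rel R ts =>
    exact (lt_aleph0_iff_set_finite.2 (finite_iUnion fun i => finite_termVars (ts i))).trans
      hκ.aleph0_lt
  | neg φ ih => exact ih
  | conj a φ ih =>
    refine (card_iUnion_lt_iff_forall_of_isRegular hκ.isRegular ?_).2 ih
    simpa using mk_Iio_lt a (by simp)
  | ex V hV φ ih => exact (mk_le_mk_of_subset sdiff_subset).trans_lt ih

theorem mk_fin_arrow_le (hμ : ℵ₀ ≤ μ) {α : Type u} (hα : #α ≤ μ) (n : ℕ) : #(Fin n → α) ≤ μ := by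
  rw [mk_arrow, lift_uzero, mk_fin, lift_natCast]
  exact (power_le_power_right hα).trans (power_nat_le hμ)

theorem mk_WType_le (hκ : κ.IsInaccessible) (hκμ : κ ≤ μ) (hμ : μ = μ ^< κ) {α : Type u}
    {β : α → Type u} (hα : #α ≤ μ) (hβ : ∀ a, #(β a) < κ) : #(WType β) ≤ μ := by
  refine WType.cardinalMk_le_of_le ((sum_le_sum _ (fun _ => μ) fun a => ?_).trans ?_)
  · conv_rhs => rw [hμ]
    exact le_powerlt μ (hβ a)
  · rw [sum_const']
    exact mul_le_of_le (aleph0_le_of_isInaccessible hκ hκμ) hα le_rfl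

theorem mk_functions_le (hL : L.card = μ) : #(Σ n, L.Functions n) ≤ μ := by
  rw [← hL, FirstOrder.Language.card, FirstOrder.Language.Symbols, mk_sum, lift_id, lift_id]
  exact self_le_add_right _ _

theorem mk_relations_le (hL : L.card = μ) : #(Σ n, L.Relations n) ≤ μ := by
  rw [← hL, FirstOrder.Language.card, FirstOrder.Language.Symbols, mk_sum, lift_id, lift_id]
  exact self_le_add_left _ _

theorem mk_formula_le (hκ : κ.IsInaccessible) (hκμ : κ ≤ μ) (hμ : μ = μ ^< κ)
    (hL : L.card = μ) : #(Formula L κ) ≤ μ := by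
  have hμ₀ := aleph0_le_of_isInaccessible hκ hκμ
  have hV : #(Var κ) ≤ μ := by simpa using hκμ
  have hT : #(L.Term (Var κ)) ≤ μ := FirstOrder.Language.Term.card_le.trans
    (max_le hμ₀ (mk_sum_le_of_le hμ₀ hV (mk_functions_le hL)))
  have h1 : (1 : Cardinal.{u}) ≤ μ := one_le_aleph0.trans hμ₀
  let A : Type u := (L.Term (Var κ) × L.Term (Var κ)) ⊕
    ((Σ r : (Σ n, L.Relations n), Fin r.1 → L.Term (Var κ)) ⊕
      (PUnit.{u + 1} ⊕ (Var κ ⊕ {V : Set (Var κ) // #V < κ})))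
  let B : A → Type u
    | .inl _ => PEmpty
    | .inr (.inl _) => PEmpty
    | .inr (.inr (.inl _)) => PUnit
    | .inr (.inr (.inr (.inl a))) => Iio a
    | .inr (.inr (.inr (.inr _))) => PUnit
  let f : WType B → Formula L κ := WType.elim _ fun p => match p with
    | ⟨.inl t, _⟩ => .eq t.1 t.2
    | ⟨.inr (.inl r), _⟩ => .rel r.1.2 r.2
    | ⟨.inr (.inr (.inl _)), φ⟩ => .neg (φ ⟨⟩)
    | ⟨.inr (.inr (.inr (.inl a))), φ⟩ => .conj a φ
    | ⟨.inr (.inr (.inr (.inr V))), φ⟩ => .ex V.1 V.2 (φ ⟨⟩)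
  have hf : Function.Surjective f := by
    intro φ
    induction φ with
    | eq s t => exact ⟨.mk (.inl (s, t)) PEmpty.elim, rfl⟩
    | rel R ts => exact ⟨.mk (.inr (.inl ⟨⟨_, R⟩, ts⟩)) PEmpty.elim, rfl⟩
    | neg φ ih =>
      obtain ⟨x, rfl⟩ := ih
      exact ⟨.mk (.inr (.inr (.inl ⟨⟩))) fun _ => x, rfl⟩
    | conj a φ ih =>
      choose x hx using ih
      obtain rfl : (fun i => f (x i)) = φ := funext hx
      exact ⟨.mk (.inr (.inr (.inr (.inl a)))) x, rfl⟩
    | ex V hV φ ih =>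
      obtain ⟨x, rfl⟩ := ih
      exact ⟨.mk (.inr (.inr (.inr (.inr ⟨V, hV⟩)))) fun _ => x, rfl⟩
  refine (mk_le_of_surjective hf).trans (mk_WType_le hκ hκμ hμ ?_ ?_)
  · exact mk_sum_le_of_le hμ₀ (mk_prod_le_of_le hμ₀ hT hT) (mk_sum_le_of_le hμ₀
      (mk_sigma_le_of_le hμ₀ (mk_relations_le hL) fun r => mk_fin_arrow_le hμ₀ hT _)
      (mk_sum_le_of_le hμ₀ (by simpa using h1) (mk_sum_le_of_le hμ₀ hV
        (mk_small_sets_le hκ hκμ hμ hV))))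
  · rintro (_ | _ | _ | a | _)
    · simpa [B] using hκ.pos
    · simpa [B] using hκ.pos
    · simpa [B] using hκ.nat_lt 1
    · simpa [B] using mk_Iio_lt a (by simp)
    · simpa [B] using hκ.nat_lt 1

/-! ### Names -/

/-- The outermost symbols of the names: function symbols, and for every formula `φ`, every set `V`
of variables and every variable `x ∈ V`, a symbol for the value of `x` in a witness of `∃ V, φ`. -/
abbrev NameSymbol (L : FirstOrder.Language.{u, u}) (κ : Cardinal.{u}) : Type u :=
  (Σ n, L.Functions n) ⊕ ({V : Set (Var κ) // #V < κ} × Formula L κ × Var κ)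

/-- A witness of `∃ V, φ` depends on the values of the free variables of `∃ V, φ`. -/
abbrev NameArity {L : FirstOrder.Language.{u, u}} {κ : Cardinal.{u}} : NameSymbol L κ → Type u
  | .inl f => ULift.{u} (Fin f.1)
  | .inr p => ↥(p.2.1.freeVars \ p.1.1)

/-- The names for elements of a model: the closed terms of the language of Henkin (or Skolem)
functions. -/
abbrev Name (L : FirstOrder.Language.{u, u}) (κ : Cardinal.{u}) : Type u :=
  WType (NameArity (L := L) (κ := κ))

namespace Name

/-- The name with outermost symbol `f`. -/
def func {n : ℕ} (f : L.Functions n) (a : Fin n → Name L κ) : Name L κ :=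
  .mk (.inl ⟨n, f⟩) fun i => a i.down

/-- The name for the value of `x` in a witness of `∃ V, φ` at `s`. -/
def wit (V : Set (Var κ)) (hV : #V < κ) (φ : Formula L κ) (s : Var κ → Name L κ) (x : Var κ) :
    Name L κ :=
  .mk (.inr (⟨V, hV⟩, φ, x)) fun y => s y

variable {M : Type u} [L.Structure M] [Nonempty M]

open Classical in
/-- The value of a name in a structure. -/
noncomputable def interp : Name L κ → M :=
  WType.elim M fun p => match p with
    | ⟨.inl f, r⟩ => FirstOrder.Language.Structure.funMap f.2 fun i => r ⟨i⟩
    | ⟨.inr (V, φ, x), r⟩ =>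
      if h : ∃ w : Var κ → M, (∀ y (hy : y ∈ φ.freeVars \ V.1), w y = r ⟨y, hy⟩) ∧ φ.Realize w
      then h.choose x else Classical.arbitrary M

theorem interp_func {n : ℕ} (f : L.Functions n) (a : Fin n → Name L κ) :
    (interp (func f a) : M) = FirstOrder.Language.Structure.funMap f fun i => interp (a i) :=
  rfl

open Classical in
theorem interp_wit {V : Set (Var κ)} {hV : #V < κ} {φ : Formula L κ} {s : Var κ → Name L κ}
    (h : (Formula.ex V hV φ).Realize fun x => (interp (s x) : M)) :
    φ.Realize fun x => (interp (if x ∈ V then wit V hV φ s x else s x) : M) := by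
  have h' : ∃ w : Var κ → M, (∀ y (_ : y ∈ φ.freeVars \ V), w y = interp (s y)) ∧ φ.Realize w := by
    obtain ⟨w, hw, hφ⟩ := h
    exact ⟨w, fun y hy => hw y hy.2, hφ⟩
  refine (Formula.realize_congr φ fun x hx => ?_).1 h'.choose_spec.2
  by_cases hxV : x ∈ V
  · rw [if_pos hxV]
    exact (dif_pos h' : _ = h'.choose x).symm
  · rw [if_neg hxV]
    exact h'.choose_spec.1 x ⟨hx, hxV⟩

/-- The value of a term, as a name. -/
def ofTerm (s : Var κ → Name L κ) : L.Term (Var κ) → Name L κ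
  | .var x => s x
  | .func f ts => func f fun i => ofTerm s (ts i)

theorem interp_ofTerm (s : Var κ → Name L κ) (t : L.Term (Var κ)) :
    (interp (ofTerm s t) : M) = t.realize fun x => interp (s x) := by
  induction t with
  | var x => rfl
  | func f ts ih =>
    simp only [ofTerm, interp_func, ih, FirstOrder.Language.Term.realize]

end Name

theorem mk_name_le (hκ : κ.IsInaccessible) (hκμ : κ ≤ μ) (hμ : μ = μ ^< κ) (hL : L.card = μ) :
    #(Name L κ) ≤ μ := by
  have hμ₀ := aleph0_le_of_isInaccessible hκ hκμ
  have hV : #(Var κ) ≤ μ := by simpa using hκμ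
  refine mk_WType_le hκ hκμ hμ (mk_sum_le_of_le hμ₀ (mk_functions_le hL)
    (mk_prod_le_of_le hμ₀ (mk_small_sets_le hκ hκμ hμ hV)
      (mk_prod_le_of_le hμ₀ (mk_formula_le hκ hκμ hμ hL) hV))) ?_
  rintro (f | ⟨V, φ, x⟩)
  · simpa [NameArity] using hκ.nat_lt f.1
  · exact (mk_le_mk_of_subset sdiff_subset).trans_lt (mk_freeVars_lt hκ φ)

/-! ### From compactness for functions to compactness with type omission -/

/-- An equality relation `E` and relations `R` between names, a satisfaction relation `σ` for names,
and a choice `ι` of formulas of `p` to be refuted by names, which on any small sets of arguments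
agree with the values of names in some structure that satisfies a given small subset of `T`. -/
def LocallyRealized (T p : Set (Formula L κ)) (E : Name L κ → Name L κ → Prop)
    (R : ∀ n, L.Relations n → (Fin n → Name L κ) → Prop)
    (σ : Formula L κ → (Var κ → Name L κ) → Prop) (ι : (Var κ → Name L κ) → Formula L κ) : Prop :=
  ∀ (JE : Set (Name L κ × Name L κ)) (JR : Set (Σ r : (Σ n, L.Relations n), Fin r.1 → Name L κ))
    (Jσ : Set (Formula L κ × (Var κ → Name L κ))) (Jι : Set (Var κ → Name L κ))
    (w : Set (Formula L κ)), #JE < κ → #JR < κ → #Jσ < κ → #Jι < κ → #w < κ →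
    ∃ (M : Type u) (_ : Nonempty M) (_ : L.Structure M),
      (∀ φ ∈ T ∩ w, ∀ v : Var κ → M, φ.Realize v) ∧
      (∀ a ∈ JE, E a.1 a.2 ↔ (a.1.interp : M) = a.2.interp) ∧
      (∀ a ∈ JR, R _ a.1.2 a.2 ↔
        FirstOrder.Language.Structure.RelMap a.1.2 fun i => ((a.2 i).interp : M)) ∧
      (∀ a ∈ Jσ, σ a.1 a.2 ↔ a.1.Realize fun x => ((a.2 x).interp : M)) ∧
      ∀ s ∈ Jι, ι s ∈ p ∧ ¬ (ι s).Realize fun x => ((s x).interp : M)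

theorem exists_locallyRealized (hFC : FunctionCompactness κ μ) (hκ : κ.IsInaccessible)
    (hκμ : κ ≤ μ) (hμ : μ = μ ^< κ) (hL : L.card = μ) {T p : Set (Formula L κ)} (hp : IsType p)
    (hTp : ∃ C, IsClub κ (T ∪ p) C ∧ ∀ x ∈ C, HasModelOmitting (x ∩ T) (x ∩ p)) :
    ∃ E R σ ι, LocallyRealized T p E R σ ι := by
  classical
  have hμ₀ := aleph0_le_of_isInaccessible hκ hκμ
  have hN : #(Name L κ) ≤ μ := mk_name_le hκ hκμ hμ hL
  have hF : #(Formula L κ) ≤ μ := mk_formula_le hκ hκμ hμ hL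
  obtain ⟨X, hX, hpX⟩ := hp
  obtain ⟨C, hC, hCM⟩ := hTp
  have hVne : Nonempty (Var κ) := by
    rw [← mk_ne_zero_iff, mk_ord_toType]
    exact hκ.ne_zero
  have : Nonempty (Formula L κ) := ⟨.eq (.var hVne.some) (.var hVne.some)⟩
  let I₂ : Type u := (Name L κ × Name L κ) ⊕ ((Σ r : (Σ n, L.Relations n), Fin r.1 → Name L κ) ⊕
    (Σ φ : Formula L κ, φ.freeVars → Name L κ))
  let sat : Formula L κ × (Var κ → Name L κ) → I₂ := fun a => .inr (.inr ⟨a.1, fun x => a.2 x⟩)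
  let res : (Var κ → Name L κ) → (X → Name L κ) := fun s x => s x
  obtain ⟨g, h, hgh⟩ := hFC.exists_limit hκ hκμ (V := Formula L κ) (I₁ := X → Name L κ) (I₂ := I₂)
    (mk_arrow_le hμ ((lt_aleph0_iff_set_finite.2 hX).trans hκ.aleph0_lt) hN)
    (mk_sum_le_of_le hμ₀ (mk_prod_le_of_le hμ₀ hN hN) (mk_sum_le_of_le hμ₀
      (mk_sigma_le_of_le hμ₀ (mk_relations_le hL) fun r => mk_fin_arrow_le hμ₀ hN _)
      (mk_sigma_le_of_le hμ₀ hF fun φ => mk_arrow_le hμ (mk_freeVars_lt hκ φ) hN))) hF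
    (fun A g h => ∃ (M : Type u) (_ : Nonempty M) (_ : L.Structure M),
      (∀ φ ∈ T ∩ A, ∀ v : Var κ → M, φ.Realize v) ∧
      (∀ a : Name L κ × Name L κ, h (.inl a) ↔ (a.1.interp : M) = a.2.interp) ∧
      (∀ a : (Σ r : (Σ n, L.Relations n), Fin r.1 → Name L κ), h (.inr (.inl a)) ↔
        FirstOrder.Language.Structure.RelMap a.1.2 fun i => ((a.2 i).interp : M)) ∧
      (∀ a, h (sat a) ↔ a.1.Realize fun x => ((a.2 x).interp : M)) ∧
      ∀ s : Var κ → Name L κ, g (res s) ∈ p ∧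
        ¬ (g (res s)).Realize fun x => ((s x).interp : M)) (by
    -- A set `A` of formulas stands for its intersection with `T ∪ p`.
    refine ⟨_, hC.comap hκ.aleph0_lt.le Function.injective_id fun _ _ => mem_univ _, ?_⟩
    rintro A ⟨-, hA⟩
    rw [preimage_id] at hA
    obtain ⟨M, hM, sM, hMT, hMp⟩ := hCM _ hA
    have hg : ∀ r : X → Name L κ, ∃ φ ∈ A ∩ p, ¬ φ.Realize fun x =>
        if hx : x ∈ X then ((r ⟨x, hx⟩).interp : M) else hM.some := by
      intro r
      by_contra! hr
      exact hMp ⟨_, fun φ hφ => hr φ ⟨hφ.1.2, hφ.2⟩⟩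
    choose g hgA hg using hg
    refine ⟨g, Sum.elim (fun a => (a.1.interp : M) = a.2.interp) (Sum.elim
      (fun a => FirstOrder.Language.Structure.RelMap a.1.2 fun i => ((a.2 i).interp : M))
      fun a => a.1.Realize fun x =>
        if hx : x ∈ a.1.freeVars then ((a.2 ⟨x, hx⟩).interp : M) else hM.some),
      fun r => (hgA r).1, M, hM, sM, fun φ hφ => hMT φ ⟨⟨Or.inl hφ.1, hφ.2⟩, hφ.1⟩,
      fun _ => Iff.rfl, fun _ => Iff.rfl, fun a => ?_, fun s => ⟨(hgA _).2, ?_⟩⟩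
    · refine Formula.realize_congr a.1 fun x hx => ?_
      rw [dif_pos hx]
    · refine fun hs => hg (res s) ((Formula.realize_congr _ fun x hx => ?_).1 hs)
      rw [dif_pos (hpX _ (hgA _).2 hx)])
  refine ⟨fun a b => h (.inl (a, b)), fun n r a => h (.inr (.inl ⟨⟨n, r⟩, a⟩)),
    fun φ s => h (sat (φ, s)), fun s => g (res s), fun JE JR Jσ Jι w h1 h2 h3 h4 h5 => ?_⟩
  obtain ⟨A, g', h', hw, ⟨M, hM, sM, hT, hE, hR, hσ, hι⟩, hg, hh⟩ := hgh (res '' Jι)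
    (.inl '' JE ∪ ((fun a => .inr (.inl a)) '' JR ∪ sat '' Jσ)) w (mk_image_le.trans_lt h4)
    (mk_union_lt hκ (mk_image_le.trans_lt h1) (mk_union_lt hκ (mk_image_le.trans_lt h2)
      (mk_image_le.trans_lt h3))) h5
  refine ⟨M, hM, sM, fun φ hφ => hT φ ⟨hφ.1, hw hφ.2⟩,
    fun a ha => (hh _ (Or.inl ⟨a, ha, rfl⟩)).trans (hE a),
    fun a ha => (hh _ (Or.inr (Or.inl ⟨a, ha, rfl⟩))).trans (hR a),
    fun a ha => (hh _ (Or.inr (Or.inr ⟨a, ha, rfl⟩))).trans (hσ a), fun s hs => ?_⟩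
  simp only [hg ⟨s, hs, rfl⟩]
  exact hι s

namespace LocallyRealized

variable {T p : Set (Formula L κ)} {E : Name L κ → Name L κ → Prop}
  {R : ∀ n, L.Relations n → (Fin n → Name L κ) → Prop}
  {σ : Formula L κ → (Var κ → Name L κ) → Prop} {ι : (Var κ → Name L κ) → Formula L κ}

theorem equivalence (hκ : κ.IsInaccessible) (H : LocallyRealized T p E R σ ι) :
    Equivalence E := by
  have h0 : ∀ {α : Type u}, #(∅ : Set α) < κ := by
    intro α
    simpa using hκ.pos
  have hfin : ∀ {α : Type u} {s : Set α}, s.Finite → #s < κ := fun hs =>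
    (lt_aleph0_iff_set_finite.2 hs).trans hκ.aleph0_lt
  refine ⟨fun a => ?_, fun {a b} hab => ?_, fun {a b c} hab hbc => ?_⟩
  · obtain ⟨M, _, _, -, hE, -⟩ := H {(a, a)} ∅ ∅ ∅ ∅ (hfin (toFinite _)) h0 h0 h0 h0
    exact (hE (a, a) rfl).2 rfl
  · obtain ⟨M, _, _, -, hE, -⟩ := H {(a, b), (b, a)} ∅ ∅ ∅ ∅ (hfin (toFinite _)) h0 h0 h0 h0
    exact (hE (b, a) (Or.inr rfl)).2 ((hE (a, b) (Or.inl rfl)).1 hab).symm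
  · obtain ⟨M, _, _, -, hE, -⟩ := H {(a, b), (b, c), (a, c)} ∅ ∅ ∅ ∅
      (hfin (toFinite _)) h0 h0 h0 h0
    exact (hE (a, c) (Or.inr (Or.inr rfl))).2 (((hE (a, b) (Or.inl rfl)).1 hab).trans
      ((hE (b, c) (Or.inr (Or.inl rfl))).1 hbc))

/-- The names modulo equality form a model of `T` which omits `p`: satisfaction in this model is
`σ`, since this holds in all the structures which realize `σ` locally. -/
theorem hasModelOmitting (hκ : κ.IsInaccessible) (H : LocallyRealized T p E R σ ι) :
    HasModelOmitting T p := by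
  classical
  have h0 : ∀ {α : Type u}, #(∅ : Set α) < κ := by
    intro α
    simpa using hκ.pos
  have hfin : ∀ {α : Type u} {s : Set α}, s.Finite → #s < κ := fun hs =>
    (lt_aleph0_iff_set_finite.2 hs).trans hκ.aleph0_lt
  let e : Setoid (Name L κ) := ⟨E, H.equivalence hκ⟩
  let Q : Type u := Quotient e
  have hQ : ∀ a b : Name L κ, (Quotient.mk e a : Q) = Quotient.mk e b ↔ E a b := fun a b =>
    Quotient.eq
  have hout : ∀ a : Name L κ, E (Quotient.mk e a).out a := fun a => Quotient.mk_out a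
  let sQ : L.Structure Q :=
    { funMap := fun f q => Quotient.mk e (Name.func f fun i => (q i).out)
      RelMap := fun {n} r q => R n r fun i => (q i).out }
  have hterm : ∀ (s : Var κ → Name L κ) (t : L.Term (Var κ)),
      (t.realize fun x => (Quotient.mk e (s x) : Q)) = Quotient.mk e (Name.ofTerm s t) := by
    intro s t
    induction t with
    | var x => rfl
    | func f ts ih =>
      simp only [FirstOrder.Language.Term.realize, ih]
      refine (hQ (Name.func f fun i => (Quotient.mk e (Name.ofTerm s (ts i))).out)
        (Name.func f fun i => Name.ofTerm s (ts i))).2 ?_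
      set a := Name.func f fun i => (Quotient.mk e (Name.ofTerm s (ts i))).out with ha
      set b := Name.func f fun i => Name.ofTerm s (ts i) with hb
      obtain ⟨M, _, _, -, hE, -⟩ := H ({(a, b)} ∪ range fun i =>
        ((Quotient.mk e (Name.ofTerm s (ts i))).out, Name.ofTerm s (ts i))) ∅ ∅ ∅ ∅
        (hfin ((finite_singleton _).union (finite_range _))) h0 h0 h0 h0
      refine (hE (a, b) (Or.inl rfl)).2 ?_
      simp only [ha, hb, Name.interp_func]
      congr 1
      funext i
      exact (hE _ (Or.inr ⟨i, rfl⟩)).1 (hout _)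
  have hsat : ∀ (φ : Formula L κ) (s : Var κ → Name L κ),
      φ.Realize (fun x => (Quotient.mk e (s x) : Q)) ↔ σ φ s := by
    intro φ
    induction φ with
    | eq t t' =>
      intro s
      simp only [Formula.Realize, hterm, hQ]
      obtain ⟨M, _, _, -, hE, -, hσ, -⟩ := H {(Name.ofTerm s t, Name.ofTerm s t')} ∅
        {(.eq t t', s)} ∅ ∅ (hfin (toFinite _)) h0 (hfin (toFinite _)) h0 h0
      rw [hE (_, _) rfl, hσ (_, _) rfl]
      simp only [Formula.Realize, Name.interp_ofTerm]
    | @rel n r ts =>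
      intro s
      simp only [Formula.Realize, hterm]
      let q : Fin n → Name L κ := fun i => (Quotient.mk e (Name.ofTerm s (ts i))).out
      obtain ⟨M, _, _, -, hE, hR, hσ, -⟩ := H (range fun i => (q i, Name.ofTerm s (ts i)))
        {⟨⟨n, r⟩, q⟩} {(.rel r ts, s)} ∅ ∅ (hfin (finite_range _)) (hfin (toFinite _))
        (hfin (toFinite _)) h0 h0
      have hq : (fun i => ((q i).interp : M)) = fun i => (ts i).realize fun x => (s x).interp := by
        funext i
        rw [← Name.interp_ofTerm]
        exact (hE _ ⟨i, rfl⟩).1 (hout _)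
      refine (hR ⟨⟨n, r⟩, q⟩ rfl).trans ?_
      rw [hσ (_, _) rfl]
      simp only [Formula.Realize, hq]
    | neg φ ih =>
      intro s
      simp only [Formula.Realize, ih]
      obtain ⟨M, _, _, -, -, -, hσ, -⟩ := H ∅ ∅ {(φ, s), (.neg φ, s)} ∅ ∅
        h0 h0 (hfin (toFinite _)) h0 h0
      rw [hσ (_, _) (Or.inl rfl), hσ (_, _) (Or.inr rfl)]
      rfl
    | conj a φ ih =>
      intro s
      simp only [Formula.Realize, ih]
      have ha : #(Iio a) < κ := by simpa using mk_Iio_lt a (by simp)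
      obtain ⟨M, _, _, -, -, -, hσ, -⟩ := H ∅ ∅ ({(.conj a φ, s)} ∪ range fun i => (φ i, s)) ∅ ∅
        h0 h0 (mk_union_lt hκ (hfin (toFinite _)) (mk_range_le.trans_lt ha)) h0 h0
      rw [hσ (_, _) (Or.inl rfl)]
      exact forall_congr' fun i => hσ (φ i, s) (Or.inr ⟨i, rfl⟩)
    | ex V hV φ ih =>
      intro s
      constructor
      · rintro ⟨w, hw, hφ⟩
        let s' : Var κ → Name L κ := fun x => if x ∈ V then (w x).out else s x
        have hs' : (fun x => (Quotient.mk e (s' x) : Q)) = w := by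
          funext x
          by_cases hx : x ∈ V
          · simp only [s', if_pos hx]
            exact Quotient.out_eq (w x)
          · simp only [s', if_neg hx]
            exact (hw x hx).symm
        rw [← hs', ih] at hφ
        obtain ⟨M, _, _, -, -, -, hσ, -⟩ := H ∅ ∅ {(φ, s'), (.ex V hV φ, s)} ∅ ∅
          h0 h0 (hfin (toFinite _)) h0 h0
        rw [hσ (_, _) (Or.inl rfl)] at hφ
        rw [hσ (_, _) (Or.inr rfl)]
        exact ⟨_, fun x hx => by simp only [s', if_neg hx], hφ⟩
      · intro hφ
        let s' : Var κ → Name L κ := fun x => if x ∈ V then Name.wit V hV φ s x else s x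
        obtain ⟨M, _, _, -, -, -, hσ, -⟩ := H ∅ ∅ {(φ, s'), (.ex V hV φ, s)} ∅ ∅
          h0 h0 (hfin (toFinite _)) h0 h0
        rw [hσ (_, _) (Or.inr rfl)] at hφ
        exact ⟨_, fun x hx => by simp only [s', if_neg hx],
          (ih s').2 ((hσ (_, _) (Or.inl rfl)).2 (Name.interp_wit hφ))⟩
  have hlift : ∀ v : Var κ → Q, (fun x => (Quotient.mk e (v x).out : Q)) = v := fun v =>
    funext fun x => Quotient.out_eq (v x)
  have hne : Nonempty (Var κ) := by
    rw [← mk_ne_zero_iff, mk_ord_toType]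
    exact hκ.ne_zero
  have hname : Nonempty (Name L κ) := by
    -- A witness of `∃ x, x = x` does not depend on other names.
    have hneg : (Formula.eq (L := L) (.var hne.some) (.var hne.some)).freeVars \ {hne.some} =
        ∅ := by
      simp [Formula.freeVars, termVars]
    refine ⟨.mk (.inr (⟨{hne.some}, hfin (finite_singleton _)⟩, .eq (.var hne.some)
      (.var hne.some), hne.some)) fun y => ?_⟩
    exact ((hneg ▸ y.2 : (y : Var κ) ∈ (∅ : Set (Var κ)))).elim
  refine ⟨Q, hname.map (Quotient.mk e), sQ, fun φ hφ v => ?_, ?_⟩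
  · rw [← hlift v, hsat]
    obtain ⟨M, _, _, hT, -, -, hσ, -⟩ := H ∅ ∅ {(φ, fun x => (v x).out)} ∅ {φ}
      h0 h0 (hfin (toFinite _)) h0 (hfin (toFinite _))
    exact (hσ (_, _) rfl).2 (hT φ ⟨hφ, rfl⟩ _)
  · rintro ⟨v, hv⟩
    let s : Var κ → Name L κ := fun x => (v x).out
    obtain ⟨M, _, _, -, -, -, hσ, hι⟩ := H ∅ ∅ {(ι s, s)} {s} ∅
      h0 h0 (hfin (toFinite _)) (hfin (toFinite _)) h0
    have hs := hv (ι s) (hι s rfl).1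
    rw [← hlift v, hsat] at hs
    exact (hι s rfl).2 ((hσ (_, _) rfl).1 hs)

end LocallyRealized

theorem FunctionCompactness.compactnessWithTypeOmission (hFC : FunctionCompactness κ μ)
    (hκ : κ.IsInaccessible) (hκμ : κ ≤ μ) (hμ : μ = μ ^< κ) :
    CompactnessWithTypeOmission κ μ := by
  intro L hL T p _ hp hTp
  obtain ⟨E, R, σ, ι, h⟩ := exists_locallyRealized hFC hκ hκμ hμ hL hp hTp
  exact h.hasModelOmitting hκ

end SubcompactLadder

theorem mainTheorem2 (κ μ : Cardinal.{u}) (hκ : κ.IsInaccessible) (hκμ : κ ≤ μ)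
    (hμ : μ = μ ^< κ) :
    List.TFAE [
      SubcompactLadder.CompactnessWithTypeOmission κ μ,
      ∀ (T : SubcompactLadder.PkTree κ μ)
        (S : ∀ x : Set (SubcompactLadder.Below μ), Set (x → Bool)),
        SubcompactLadder.IsLadderSystem T S →
          ∃ b, SubcompactLadder.IsBranch T b ∧ SubcompactLadder.MeetsClubOften κ b S,
      ∀ (T : SubcompactLadder.PkTree κ μ)
        (S : ∀ x : Set (SubcompactLadder.Below μ), Set (x → Bool)),
        SubcompactLadder.IsLadderSystem T S →
          ∃ b, SubcompactLadder.IsBranch T b ∧ SubcompactLadder.MeetsCofinally κ b S] := by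
  tfae_have 1 → 2 := fun h => (h.functionCompactness hκ hκμ).exists_branch hκ hκμ hμ
  tfae_have 2 → 3 := by
    intro h T S hS
    obtain ⟨b, hb, C, hC, hCS⟩ := h T S hS
    refine ⟨b, hb, fun x hx => ?_⟩
    obtain ⟨z, hz, hxz⟩ := hC.cofinal x hx
    exact ⟨z, hC.subset hz, hxz, hCS z hz⟩
  tfae_have 3 → 1 := fun h =>
    (SubcompactLadder.functionCompactness_of_ladder hκ hκμ h).compactnessWithTypeOmission hκ hκμ hμ
  tfae_finish
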